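/- Setting. Regard $\mathbb{Z}^d$ as the Cayley graph with respect to the standard generators (oriented, generator-labelled edges), and let $B_r$ be the ball of radius $r$ around the origin in the graph distance. An LCL $\Pi$ of locality $t$ on $\mathbb{Z}^d$ is given by finite sets $\Sigma_{in},\Sigma_{out}$ and a set $\mathcal{P}$ of labellings $B_t\to\Sigma_{in}\times\Sigma_{out}$. Given an input labelling, an output labelling is a correct solution if the labelled $t$-ball around every vertex belongs to $\mathcal{P}$. A uniform local algorithm $\mathcal{A}$ (equivalently, a finitary factor of iid) explores around a vertex the balls of radius $0,1,2,\dots$, whose vertices carry input labels and independent uniform random labels from $[0,1]$, and decides (measurably in the random labels) after each radius, from the labelled ball, whether to stop and output an element of $\Sigma_{out}$ or to go on. Its coding radius $R_{\mathcal A}\in\mathbb{N}\cup\{\infty\}$ is the radius at which it stops at the origin. It solves $\Pi$ if for every input labelling, almost surely, it stops at every vertex and the outputs form a correct solution. For a function $f$, $\Pi\in\mathsf{ULOCAL}(f(\varepsilon))$ means that some uniform local algorithm solves $\Pi$ and satisfies $\sup \mathbb{P}(R_{\mathcal A}>f(\varepsilon))\le\varepsilon$ for all sufficiently small $\varepsilon>0$,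 the supremum being over all input labellings. $\mathsf{ULOCAL}(O(\log^*1/\varepsilon))$ is the union of $\mathsf{ULOCAL}(f(\varepsilon))$ over all $f(\varepsilon)=O(\log^*1/\varepsilon)$ as $\varepsilon\to0$, and $\mathsf{ffiid}$ is the union over all functions $f$. A deterministic local algorithm of complexity $T(n)$ computes an output label from $n$ and the ball of radius $T(n)$ labelled by identifiers and input labels. $\Pi\in\mathsf{LOCAL}(O(\log^* n))$ means that for all constants $K>0$ and $k\in\mathbb{N}$ there is such an algorithm with $T(n)=O(\log^* n)$ which, for all sufficiently large $n$, produces a correct solution on every $d$-dimensional torus with $n$ vertices and side lengths in $[n^{1/d}/K,\,K n^{1/d}]$, for all input labels and all assignments of distinct identifiers from $\{1,\dots,n^k\}$. Theorem. (1) Let $d,t\in\mathbb{N}$, $d\ge2$. There is a constant $C_{d,t}>0$ such that for every LCL $\Pi$ of locality $t$ on $\mathbb{Z}^d$ $$\Pi\in\mathsf{ULOCAL}\bigl(C_{d,t}\sqrt[d-1]{1/\varepsilon}\bigr)\iff\Pi\in\mathsf{ULOCAL}(O(\log^*1/\varepsilon)),$$ and every $\Pi\in\mathsf{ULOCAL}\bigl(C_{d,t}\sqrt[d-1]{1/\varepsilon}\bigr)$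 also lies in $\mathsf{LOCAL}(O(\log^* n))$. (2) For $d=1$, an LCL $\Pi$ on $\mathbb{Z}$ (of any locality) is in $\mathsf{ffiid}$ if and only if it is in $\mathsf{ULOCAL}(O(\log^*1/\varepsilon))$. -/

import Mathlib

open MeasureTheory Filter Topology Asymptotics

namespace GridLCL

/-- `tower k = 2 ^ 2 ^ ... ^ 2` with `k` twos. -/
def tower : ℕ → ℕ
  | 0 => 1
  | k + 1 => 2 ^ tower k

/-- The iterated logarithm to base two: the least `k` such that a tower of `k` twos is at least `x`,
that is, the number of times `log₂` has to be applied to `x` to reach a value at most `1`. -/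
noncomputable def logStar (x : ℝ) : ℕ := sInf {k : ℕ | x ≤ (tower k : ℝ)}

/-- The vertices of the grid `ℤ^d`. The grid is the Cayley graph of `ℤ^d` with respect to the
standard generators, with oriented edges that are labelled by the generators. -/
abbrev Vertex (d : ℕ) : Type := Fin d → ℤ

/-- The ball of radius `r` around the origin of `ℤ^d` in the graph distance, which is the
`ℓ¹`-distance. As edges are oriented and labelled by generators, the ball, rooted at its centre, has
no nontrivial automorphism, and a labelled rooted grid of radius `r` is a function on `Ball d r`. -/
abbrev Ball (d r : ℕ) : Type := {u : Vertex d // ∑ i, |u i| ≤ (r : ℤ)}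

/-- The labelled ball of radius `r` around `v`, as seen from `v`, in a labelling of `ℤ^d`. -/
def view {d : ℕ} {α : Type*} (x : Vertex d → α) (v : Vertex d) (r : ℕ) : Ball d r → α :=
  fun u => x (v + u.1)

/-- A locally checkable problem on `ℤ^d` of locality `t`, with the set `In` of input labels and the
set `Out` of output labels: the set of allowed labelled rooted grids of radius `t`. -/
structure LCL (d t : ℕ) (In Out : Type*) where
  /-- the allowed neighbourhoods -/
  allowed : Set (Ball d t → In × Out)

/-- The output labelling `c` of `ℤ^d` is a correct solution for the input labelling `x`. -/
def LCL.IsColoring {d t : ℕ} {In Out : Type*} (P : LCL d t In Out)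
    (x : Vertex d → In) (c : Vertex d → Out) : Prop :=
  ∀ v, view (fun w => (x w, c w)) v t ∈ P.allowed

/-! ### Uniform local algorithms -/

/-- The law of a labelling of `ℤ^d` by independent uniform random elements of `[0,1]`. -/
noncomputable def iidLaw (d : ℕ) : Measure (Vertex d → unitInterval) :=
  Measure.infinitePi fun _ => (volume : Measure unitInterval)

/-- A uniform local algorithm explores balls of radius `0, 1, 2, ...` around a vertex, with their
input labels and their random labels. After having seen the ball of radius `r` it may stop and
output a label (`some o`), or go on (`none`). -/
structure UniformAlgorithm (d : ℕ) (In Out : Type*) where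
  /-- the decision of the algorithm after it has seen a labelled ball of radius `r` -/
  rule : (r : ℕ) → (Ball d r → In) → (Ball d r → unitInterval) → Option Out
  measurable_rule : ∀ (r : ℕ) (x : Ball d r → In) (o : Option Out),
    MeasurableSet {y : Ball d r → unitInterval | rule r x y = o}

namespace UniformAlgorithm

variable {d : ℕ} {In Out : Type*}

/-- The algorithm, run at the vertex `v`, stops and outputs the label `o`. -/
def Outputs (A : UniformAlgorithm d In Out) (x : Vertex d → In) (y : Vertex d → unitInterval)
    (v : Vertex d) (o : Out) : Prop :=
  ∃ r : ℕ, A.rule r (view x v r) (view y v r) = some o ∧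
    ∀ s < r, A.rule s (view x v s) (view y v s) = none

/-- The coding radius at the origin: the least radius at which the algorithm stops, and `∞` if it
never stops. -/
noncomputable def codingRadius (A : UniformAlgorithm d In Out) (x : Vertex d → In)
    (y : Vertex d → unitInterval) : ℕ∞ :=
  ⨅ (r : ℕ) (_ : A.rule r (view x 0 r) (view y 0 r) ≠ none), (r : ℕ∞)

/-- For every input labelling, almost surely the algorithm stops at every vertex and its outputs
form a correct solution. -/
def Solves {t : ℕ} (A : UniformAlgorithm d In Out) (P : LCL d t In Out) : Prop :=
  ∀ x : Vertex d → In, ∀ᵐ y ∂(iidLaw d),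
    ∃ c : Vertex d → Out, (∀ v, A.Outputs x y v (c v)) ∧ P.IsColoring x c

/-- The algorithm has uniform complexity `f`: for all small enough `ε > 0`, whatever the input
labels are, the probability that the coding radius is larger than `f ε` is at most `ε`. -/
def HasComplexity (A : UniformAlgorithm d In Out) (f : ℝ → ℝ) : Prop :=
  ∀ᶠ ε in 𝓝[>] (0 : ℝ), ∀ x : Vertex d → In,
    iidLaw d {y | (f ε : EReal) < ((A.codingRadius x y : ENNReal) : EReal)} ≤ ENNReal.ofReal ε

end UniformAlgorithm

namespace LCL

variable {d t : ℕ} {In Out : Type*}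

/-- The class `ULOCAL(f(ε))`. -/
def InULOCAL (P : LCL d t In Out) (f : ℝ → ℝ) : Prop :=
  ∃ A : UniformAlgorithm d In Out, A.Solves P ∧ A.HasComplexity f

/-- The class `ULOCAL(O(log* 1/ε))`. -/
def InULOCALLogStar (P : LCL d t In Out) : Prop :=
  ∃ f : ℝ → ℝ, f =O[𝓝[>] (0 : ℝ)] (fun ε => (logStar (1 / ε) : ℝ)) ∧ P.InULOCAL f

/-- The class `ffiid`: the union of `ULOCAL(f(ε))` over all functions `f`. -/
def InFFIID (P : LCL d t In Out) : Prop :=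
  ∃ f : ℝ → ℝ, P.InULOCAL f

end LCL

/-! ### Deterministic local algorithms on tori -/

/-- The vertices of the `d`-dimensional torus with side lengths `m i`. -/
abbrev Torus {d : ℕ} (m : Fin d → ℕ) : Type := (i : Fin d) → ZMod (m i)

/-- The labelled neighbourhood of radius `r` of a vertex of a torus, as seen from that vertex. -/
def torusView {d : ℕ} {m : Fin d → ℕ} {α : Type*} (x : Torus m → α) (v : Torus m) (r : ℕ) :
    Ball d r → α :=
  fun u => x (v + fun i => ((u.1 i : ℤ) : ZMod (m i)))

/-- The output labelling `c` of a torus is a correct solution for the input labelling `x`. -/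
def LCL.IsTorusColoring {d t : ℕ} {In Out : Type*} (P : LCL d t In Out) {m : Fin d → ℕ}
    (x : Torus m → In) (c : Torus m → Out) : Prop :=
  ∀ v, torusView (fun w => (x w, c w)) v t ∈ P.allowed

/-- A deterministic local algorithm: it knows the number `n` of vertices and computes an output
label from the identifiers and the input labels in the ball of radius `radius n`. -/
structure LocalAlgorithm (d : ℕ) (In Out : Type*) where
  /-- the local complexity -/
  radius : ℕ → ℕ
  /-- the output label, given identifiers and input labels -/
  rule : (n : ℕ) → (Ball d (radius n) → ℕ) → (Ball d (radius n) → In) → Out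

/-- The algorithm solves the problem on all tori that have `n` vertices and side lengths between
`n ^ (1 / d) / K` and `K * n ^ (1 / d)`, for `n` large enough, for all input labels and for all
assignments of unique identifiers from `{1, ..., n ^ k}`. -/
def LocalAlgorithm.Solves {d t : ℕ} {In Out : Type*} (A : LocalAlgorithm d In Out)
    (P : LCL d t In Out) (K : ℝ) (k : ℕ) : Prop :=
  ∀ᶠ n : ℕ in atTop, ∀ m : Fin d → ℕ, ∏ i, m i = n →
    (∀ i, (n : ℝ) ^ (1 / (d : ℝ)) / K ≤ m i ∧ (m i : ℝ) ≤ K * (n : ℝ) ^ (1 / (d : ℝ))) →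
    ∀ ids : Torus m → ℕ, Function.Injective ids → (∀ v, 1 ≤ ids v ∧ ids v ≤ n ^ k) →
    ∀ x : Torus m → In, P.IsTorusColoring x fun v =>
      A.rule n (torusView ids v (A.radius n)) (torusView x v (A.radius n))

/-- The class `LOCAL(O(log* n))`: for all constants hidden in "side lengths `Θ(n ^ (1 / d))`" and
"identifiers from `[n ^ O(1)]`" there is a local algorithm of complexity `O(log* n)`. -/
def LCL.InLOCALLogStar {d t : ℕ} {In Out : Type*} (P : LCL d t In Out) : Prop :=
  ∀ (K : ℝ) (k : ℕ), 0 < K → ∃ A : LocalAlgorithm d In Out,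
    (fun n : ℕ => (A.radius n : ℝ)) =O[atTop] (fun n : ℕ => (logStar n : ℝ)) ∧ A.Solves P K k

end GridLCL

/-!
A uniform algorithm that fails to stop after radius `r` with probability less than a small multiple
of `r ^ (1 - d)`, for a single radius `r`, already yields a solution of the problem by a *local*
rule, that is, a block code of constant radius, which is applied to a colouring of a power of the
grid with finitely many colours. Such a colouring is computed in `O(log*)` rounds, from identifiers
as well as from random labels.

*From the algorithm to a local rule.* A colouring gives a maximal `r`-separated set of vertices. The
boxes of radius `r` around its points cover the grid, and each box is surrounded by a shell of
thickness `2 t`, which has `O(r ^ (d - 1))` vertices. The bad event at a point is that the algorithm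
does not stop after radius `r` at some vertex of its shell (or that the outputs do not extend to a
solution nearby, which has probability zero). By assumption it has small probability, and each bad
event interacts with at most `9 ^ d` boxes, by a packing bound. So there are labels that avoid all
bad events, and these are found locally: the points fix the random labels in their boxes, one colour
class after another, and each of these choices increases the conditional probabilities of the
bad events nearby by a factor of at most `9 ^ d + 1` (`exists_fill`, `exists_local_avoiding`). The
outputs are then determined on the shells, and the undetermined vertices split into
bounded parts that are far from each other. In each of them the outputs are completed by a
solution around a nearby point, which exists since the bad event does not occur
(`LCL.isColoring_combine`, `LCL.exists_local_solver`).

*Colourings.* Colours are reduced by the method of Cole and Vishkin along the paths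
`v, v + u, v + 2 u, ...`, for each short vector `u` separately (`reduceAll`). Applied to
identifiers this gives the deterministic algorithm (`LCL.inLOCALLogStar_of_local`), since labellings
of a torus lift to labellings of `ℤ^d`. For the uniform algorithm, stage `i` rounds the random
labels to `tower (2 ^ i)` values, ignores the vertices with collisions nearby, reduces the colours
in `2 ^ i` steps, and extends the partial colouring of the previous stages greedily to the newly
coloured vertices. The radii of the stages form a geometric series, and the probability that a
vertex is not coloured after stage `i` is of order `1 / tower (2 ^ i)`
(`LCL.inULOCALLogStar_of_local`).

In dimension one the shells have bounded size, so that any decay of the failure probability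
suffices (`LCL.InFFIID.speed_up`).
-/

namespace GridLCL

/-! ### Boxes and local maps -/

/-- The vertices of `ℤ^d` of sup norm at most `ρ`. Sup norm boxes replace the `ℓ¹`-balls of the
statement in all constructions. -/
noncomputable def box (d ρ : ℕ) : Finset (Vertex d) :=
  Fintype.piFinset fun _ => Finset.Icc (-(ρ : ℤ)) ρ

@[simp]
lemma mem_box {d ρ : ℕ} {u : Vertex d} : u ∈ box d ρ ↔ ∀ i, |u i| ≤ (ρ : ℤ) := by
  simp [box, abs_le]

lemma box_mono {d ρ σ : ℕ} (h : ρ ≤ σ) {u : Vertex d} (hu : u ∈ box d ρ) : u ∈ box d σ := by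
  rw [mem_box] at *
  exact fun i => (hu i).trans (by exact_mod_cast h)

lemma zero_mem_box (d ρ : ℕ) : (0 : Vertex d) ∈ box d ρ := by simp

lemma add_mem_box {d ρ σ : ℕ} {u v : Vertex d} (hu : u ∈ box d ρ) (hv : v ∈ box d σ) :
    u + v ∈ box d (ρ + σ) := by
  rw [mem_box] at *
  intro i
  have := abs_add_le (u i) (v i)
  have := hu i
  have := hv i
  push_cast
  rw [Pi.add_apply]
  linarith

lemma neg_mem_box {d ρ : ℕ} {u : Vertex d} (hu : u ∈ box d ρ) : -u ∈ box d ρ := by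
  simpa using hu

lemma sub_mem_box {d ρ σ : ℕ} {u v : Vertex d} (hu : u ∈ box d ρ) (hv : v ∈ box d σ) :
    u - v ∈ box d (ρ + σ) := by
  rw [sub_eq_add_neg]
  exact add_mem_box hu (neg_mem_box hv)

lemma sub_mem_box_comm {d ρ : ℕ} {u v : Vertex d} : u - v ∈ box d ρ ↔ v - u ∈ box d ρ := by
  simp [abs_sub_comm]

lemma card_box (d ρ : ℕ) : (box d ρ).card = (2 * ρ + 1) ^ d := by
  rw [box, Fintype.card_piFinset]
  simp only [Int.card_Icc, Finset.prod_const, Finset.card_univ, Fintype.card_fin]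
  congr 1
  omega

lemma mem_box_of_ball {d r : ℕ} (u : Ball d r) : u.1 ∈ box d r := by
  rw [mem_box]
  intro i
  exact (Finset.single_le_sum (f := fun i => |u.1 i|) (fun j _ => abs_nonneg _)
    (Finset.mem_univ i)).trans u.2

lemma sum_abs_le_of_mem_box {d ρ r : ℕ} (h : d * ρ ≤ r) {u : Vertex d} (hu : u ∈ box d ρ) :
    ∑ i, |u i| ≤ (r : ℤ) := by
  rw [mem_box] at hu
  calc ∑ i, |u i| ≤ ∑ _i : Fin d, (ρ : ℤ) := Finset.sum_le_sum fun i _ => hu i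
    _ = ((d * ρ : ℕ) : ℤ) := by simp
    _ ≤ r := by exact_mod_cast h

/-- The labelling `x` as seen from the vertex `p`. -/
def shift {d : ℕ} {α : Type*} (p : Vertex d) (x : Vertex d → α) : Vertex d → α := fun u => x (p + u)

/-- `H` is a block code of radius `ρ`: the new label of a vertex depends only on the old labels in
the box of radius `ρ` around it, as seen from that vertex. -/
def IsLocal {d : ℕ} {α β : Type*} (ρ : ℕ) (H : (Vertex d → α) → Vertex d → β) : Prop :=
  ∀ x x' : Vertex d → α, ∀ v v' : Vertex d,
    (∀ u ∈ box d ρ, x (v + u) = x' (v' + u)) → H x v = H x' v'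

section IsLocal

variable {d ρ σ : ℕ} {α β γ : Type*}

lemma IsLocal.mono {H : (Vertex d → α) → Vertex d → β} (hH : IsLocal ρ H) (h : ρ ≤ σ) :
    IsLocal σ H := fun x x' v v' hx => hH x x' v v' fun u hu => hx u (box_mono h hu)

lemma IsLocal.of_pointwise (f : α → β) : IsLocal (d := d) 0 fun x v => f (x v) :=
  fun x x' v v' h => by simpa using congrArg f (h 0 (zero_mem_box d 0))

lemma IsLocal.agree {H : (Vertex d → α) → Vertex d → β} (hH : IsLocal ρ H)
    {x x' : Vertex d → α} {v v' : Vertex d} (h : ∀ u ∈ box d (σ + ρ), x (v + u) = x' (v' + u)) :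
    ∀ u ∈ box d σ, H x (v + u) = H x' (v' + u) := by
  intro u hu
  refine hH _ _ _ _ fun w hw => ?_
  rw [add_assoc, add_assoc]
  exact h _ (add_mem_box hu hw)

lemma IsLocal.comp {G : (Vertex d → β) → Vertex d → γ} {H : (Vertex d → α) → Vertex d → β}
    (hG : IsLocal σ G) (hH : IsLocal ρ H) : IsLocal (σ + ρ) fun x => G (H x) :=
  fun _ _ _ _ h => hG _ _ _ _ (hH.agree h)

lemma IsLocal.prodMk {G : (Vertex d → α) → Vertex d → γ} {H : (Vertex d → α) → Vertex d → β}
    (hG : IsLocal σ G) (hH : IsLocal ρ H) :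
    IsLocal (max σ ρ) fun x v => (G x v, H x v) :=
  fun x x' v v' h => Prod.ext (hG.mono (le_max_left _ _) x x' v v' h)
    (hH.mono (le_max_right _ _) x x' v v' h)

lemma IsLocal.shift_eq {H : (Vertex d → α) → Vertex d → β} (hH : IsLocal ρ H)
    (x : Vertex d → α) (p v : Vertex d) : H (shift p x) v = H x (p + v) :=
  hH _ _ _ _ fun u _ => by simp [shift, add_assoc]

/-- Sequential processing of the labelling `x`, where step `a` updates all states according to the
local rule `S a`. The rules used below change, in step `a`, only the states of (or near) the
vertices of colour `a`, so that this is a greedy algorithm that runs through the colour classes. -/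
def sweep (S : ℕ → (Vertex d → α × β) → Vertex d → β) (init : α → β) :
    ℕ → (Vertex d → α) → Vertex d → β
  | 0 => fun x v => init (x v)
  | a + 1 => fun x => S a fun v => (x v, sweep S init a x v)

lemma IsLocal.sweep {S : ℕ → (Vertex d → α × β) → Vertex d → β} (init : α → β)
    (hS : ∀ a, IsLocal ρ (S a)) (a : ℕ) : IsLocal (ρ * a) (sweep S init a) := by
  induction a with
  | zero => exact IsLocal.of_pointwise init
  | succ a ih =>
    have := (hS a).comp ((IsLocal.of_pointwise (id : α → α)).prodMk ih)
    refine this.mono ?_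
    rw [Nat.zero_max, mul_add, mul_one, add_comm]

lemma IsLocal.iterate {H : (Vertex d → α) → Vertex d → α} (hH : IsLocal ρ H) (j : ℕ) :
    IsLocal (ρ * j) fun x => H^[j] x := by
  induction j with
  | zero => exact IsLocal.of_pointwise id
  | succ j ih =>
    have := ih.comp hH
    simpa only [Function.iterate_succ, Function.comp_apply, mul_add, mul_one] using this

end IsLocal

/-- The colouring `col` distinguishes different vertices of sup distance at most `k`. -/
def ProperAt {d : ℕ} {α : Type*} (k : ℕ) (col : Vertex d → α) : Prop :=
  ∀ v, ∀ u ∈ box d k, u ≠ 0 → col v ≠ col (v + u)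

lemma ProperAt.eq_of_sub_mem {d k : ℕ} {α : Type*} {col : Vertex d → α} (h : ProperAt k col)
    {p q : Vertex d} (hpq : q - p ∈ box d k) (hc : col p = col q) : p = q := by
  by_contra hne
  refine h p (q - p) hpq (sub_ne_zero.2 (Ne.symm hne)) ?_
  simpa using hc

/-! ### Maximal separated sets -/

/-- One step of the greedy construction of a maximal `r`-separated set: the vertices of colour `a`
without an earlier selected vertex at distance at most `r` are selected. -/
def separatedStep {d : ℕ} (r a : ℕ) (s : Vertex d → ℕ × Prop) (v : Vertex d) : Prop :=
  (s v).2 ∨ ((s v).1 = a ∧ ∀ u ∈ box d r, ¬ (s (v + u)).2)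

/-- The `r`-separated set of vertices selected from the first `q` colour classes of `col`. -/
def separated {d : ℕ} (r q : ℕ) (col : Vertex d → ℕ) : Vertex d → Prop :=
  sweep (separatedStep r) (fun _ => False) q col

lemma separated_succ {d r a : ℕ} {col : Vertex d → ℕ} {v : Vertex d} :
    separated r (a + 1) col v ↔ separated r a col v ∨
      (col v = a ∧ ∀ u ∈ box d r, ¬ separated r a col (v + u)) := Iff.rfl

lemma isLocal_separatedStep {d : ℕ} (r a : ℕ) : IsLocal (d := d) r (separatedStep r a) := by
  intro x x' v v' h
  have h0 : x v = x' v' := by simpa using h 0 (zero_mem_box d r)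
  unfold separatedStep
  rw [h0]
  congr 2
  refine forall_congr fun u => ?_
  refine forall_congr fun hu => ?_
  rw [h u hu]

lemma isLocal_separated {d : ℕ} (r q : ℕ) : IsLocal (d := d) (r * q) (separated r q) :=
  IsLocal.sweep _ (isLocal_separatedStep r) q

lemma separated_col_lt {d r a : ℕ} {col : Vertex d → ℕ} {v : Vertex d}
    (h : separated r a col v) : col v < a := by
  induction a with
  | zero => exact h.elim
  | succ a ih =>
    rcases separated_succ.1 h with h | h
    · exact (ih h).trans (Nat.lt_succ_self a)
    · omega

lemma exists_separated_near {d r q : ℕ} {col : Vertex d → ℕ} {v : Vertex d} (h : col v < q) :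
    ∃ u ∈ box d r, separated r q col (v + u) := by
  induction q with
  | zero => omega
  | succ q ih =>
    by_cases hc : ∃ u ∈ box d r, separated r q col (v + u)
    · obtain ⟨u, hu, hs⟩ := hc
      exact ⟨u, hu, separated_succ.2 (Or.inl hs)⟩
    · push Not at hc
      have hcol : col v = q := by
        by_contra hne
        obtain ⟨u, hu, hs⟩ := ih (by omega)
        exact hc u hu hs
      refine ⟨0, zero_mem_box d r, separated_succ.2 (Or.inr ?_)⟩
      simpa using ⟨hcol, fun u hu => hc u (by simpa using hu)⟩

lemma separated_eq {d r q : ℕ} {col : Vertex d → ℕ} (hcol : ProperAt r col) {p p' : Vertex d}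
    (hp : separated r q col p) (hp' : separated r q col p') (h : p' - p ∈ box d r) : p = p' := by
  induction q with
  | zero => exact hp.elim
  | succ q ih =>
    rcases separated_succ.1 hp with h1 | ⟨h1, h1'⟩ <;>
      rcases separated_succ.1 hp' with h2 | ⟨h2, h2'⟩
    · exact ih h1 h2
    · refine absurd h1 ?_
      have := h2' (p - p') (sub_mem_box_comm.1 h)
      simpa using this
    · refine absurd h2 ?_
      have := h1' (p' - p) h
      simpa using this
    · exact hcol.eq_of_sub_mem h (h1.trans h2.symm)

/-- A box of radius `4 r` contains at most `9 ^ d` points with pairwise sup distance more than `r`,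
because it is covered by `9 ^ d` cubes of side length `r`. -/
lemma card_separated_le {d r : ℕ} (hr : 0 < r) (s : Finset (Vertex d)) (hs : s ⊆ box d (4 * r))
    (hsep : ∀ p ∈ s, ∀ p' ∈ s, p' - p ∈ box d r → p = p') : s.card ≤ 9 ^ d := by
  have hr' : (0 : ℤ) < r := by exact_mod_cast hr
  have hmaps : ∀ p ∈ s, (fun i => (p i + 4 * r) / (r : ℤ)) ∈
      Fintype.piFinset fun _ : Fin d => Finset.Icc (0 : ℤ) 8 := by
    intro p hp
    have h1 := mem_box.1 (hs hp)
    simp only [Fintype.mem_piFinset, Finset.mem_Icc]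
    intro i
    have h2 := abs_le.1 (h1 i)
    push_cast at h2
    constructor
    · exact Int.ediv_nonneg (by linarith) hr'.le
    · rw [← Int.lt_add_one_iff]
      exact Int.ediv_lt_of_lt_mul hr' (by linarith)
  have hcard := Finset.card_le_card_of_injOn _ hmaps (by
    intro p hp p' hp' h
    refine hsep p hp p' hp' (mem_box.2 fun i => ?_)
    have hi := congrFun h i
    simp only at hi
    have e1 := Int.emod_add_mul_ediv (p i + 4 * r) r
    have e2 := Int.emod_add_mul_ediv (p' i + 4 * r) r
    have b1 := Int.emod_nonneg (p i + 4 * r) hr'.ne'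
    have b2 := Int.emod_nonneg (p' i + 4 * r) hr'.ne'
    have b3 := Int.emod_lt_of_pos (p i + 4 * r) hr'
    have b4 := Int.emod_lt_of_pos (p' i + 4 * r) hr'
    rw [hi] at e1
    rw [Pi.sub_apply, abs_le]
    constructor <;> linarith)
  simpa using hcard

/-! ### Random labels -/

instance (d : ℕ) : IsProbabilityMeasure (iidLaw d) := by
  unfold iidLaw
  infer_instance

lemma measurable_shift {d : ℕ} {α : Type*} [MeasurableSpace α] (p : Vertex d) :
    Measurable (shift p : (Vertex d → α) → Vertex d → α) :=
  measurable_pi_lambda _ fun u => measurable_pi_apply (p + u)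

lemma measurePreserving_shift {d : ℕ} (p : Vertex d) :
    MeasurePreserving (shift p) (iidLaw d) (iidLaw d) := by
  refine ⟨measurable_shift p, Measure.eq_infinitePi _ fun s t ht => ?_⟩
  classical
  rw [Measure.map_apply (measurable_shift p) (MeasurableSet.pi s.countable_toSet fun i _ => ht i)]
  have hpre : shift p ⁻¹' (Set.pi s t) =
      Set.pi (s.map (Equiv.addLeft p).toEmbedding) fun i => t (-p + i) := by
    ext y
    simp only [shift, Set.mem_preimage, Set.mem_pi, Finset.mem_coe, Finset.mem_map,
      Equiv.coe_toEmbedding, Equiv.coe_addLeft, forall_exists_index, and_imp,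
      forall_apply_eq_imp_iff₂, neg_add_cancel_left]
  rw [hpre, iidLaw, Measure.infinitePi_pi _ fun i _ => ht _, Finset.prod_map]
  simp

/-- Take the labels in `N` from `z`, and those outside `N` from `y`. -/
noncomputable def mix {d : ℕ} {α : Type*} (N : Finset (Vertex d)) (z y : Vertex d → α) :
    Vertex d → α :=
  fun v => if v ∈ N then z v else y v

lemma measurable_mix {d : ℕ} {α : Type*} [MeasurableSpace α] (N : Finset (Vertex d)) :
    Measurable fun a : (Vertex d → α) × (Vertex d → α) => mix N a.1 a.2 := by
  refine measurable_pi_lambda _ fun v => ?_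
  by_cases h : v ∈ N
  · simp only [mix, h, if_true]
    fun_prop
  · simp only [mix, h, if_false]
    fun_prop

lemma measurePreserving_mix {d : ℕ} (N : Finset (Vertex d)) :
    MeasurePreserving (fun a : (Vertex d → unitInterval) × (Vertex d → unitInterval) =>
      mix N a.1 a.2) ((iidLaw d).prod (iidLaw d)) (iidLaw d) := by
  refine ⟨measurable_mix N, Measure.eq_infinitePi _ fun s t ht => ?_⟩
  rw [Measure.map_apply (measurable_mix N) (MeasurableSet.pi s.countable_toSet fun i _ => ht i)]
  have hpre : (fun a : (Vertex d → unitInterval) × (Vertex d → unitInterval) =>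
      mix N a.1 a.2) ⁻¹' (Set.pi s t) =
      (Set.pi (s.filter (· ∈ N)) t) ×ˢ (Set.pi (s.filter (· ∉ N)) t) := by
    ext ⟨z, y⟩
    simp only [Set.mem_preimage, Set.mem_pi, Set.mem_prod, Finset.coe_filter, Set.mem_ofPred_eq,
      mix, Finset.mem_coe]
    constructor
    · intro h
      exact ⟨fun i hi => by simpa [hi.2] using h i hi.1, fun i hi => by simpa [hi.2] using h i hi.1⟩
    · intro h i hi
      by_cases hN : i ∈ N
      · simpa [hN] using h.1 i ⟨hi, hN⟩
      · simpa [hN] using h.2 i ⟨hi, hN⟩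
  rw [hpre, Measure.prod_prod, iidLaw, Measure.infinitePi_pi _ fun i _ => ht _,
    Measure.infinitePi_pi _ fun i _ => ht _, Finset.prod_filter_mul_prod_filter_not]

/-- Complete the partial labelling `Y` by the labels of `y`. -/
def glue {d : ℕ} {α : Type*} (Y : Vertex d → Option α) (y : Vertex d → α) : Vertex d → α :=
  fun v => (Y v).getD (y v)

/-- Extend the partial labelling `Y` to `N` by the labels of `z`. -/
noncomputable def fill {d : ℕ} {α : Type*} (Y : Vertex d → Option α) (N : Finset (Vertex d))
    (z : Vertex d → α) : Vertex d → Option α :=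
  fun v => if Y v = none ∧ v ∈ N then some (z v) else Y v

lemma glue_fill {d : ℕ} {α : Type*} (Y : Vertex d → Option α) (N : Finset (Vertex d))
    (z y : Vertex d → α) : glue (fill Y N z) y = glue Y (mix N z y) := by
  funext v
  unfold glue fill mix
  cases h : Y v <;> by_cases hv : v ∈ N <;> simp [hv]

lemma measurable_glue {d : ℕ} {α : Type*} [MeasurableSpace α] (Y : Vertex d → Option α) :
    Measurable (glue Y) := by
  refine measurable_pi_lambda _ fun v => ?_
  unfold glue
  cases Y v with
  | none => exact measurable_pi_apply v
  | some a => exact measurable_const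

/-- The conditional probability of the event `B`, given that the random labels extend `Y`. -/
noncomputable def condProb {d : ℕ} (B : Set (Vertex d → unitInterval))
    (Y : Vertex d → Option unitInterval) : ENNReal :=
  iidLaw d {y | glue Y y ∈ B}

lemma lintegral_condProb_fill {d : ℕ} {B : Set (Vertex d → unitInterval)} (hB : MeasurableSet B)
    (Y : Vertex d → Option unitInterval) (N : Finset (Vertex d)) :
    ∫⁻ z, condProb B (fill Y N z) ∂(iidLaw d) = condProb B Y := by
  have hB' : MeasurableSet {y | glue Y y ∈ B} := measurable_glue Y hB
  have h := (measurePreserving_mix N).measure_preimage hB'.nullMeasurableSet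
  rw [Measure.prod_apply (measurable_mix N hB')] at h
  rw [condProb, ← h]
  simp only [condProb, glue_fill]
  rfl

lemma measurable_condProb_fill {d : ℕ} {B : Set (Vertex d → unitInterval)} (hB : MeasurableSet B)
    (Y : Vertex d → Option unitInterval) (N : Finset (Vertex d)) :
    Measurable fun z => condProb B (fill Y N z) := by
  have hB' : MeasurableSet {y | glue Y y ∈ B} := measurable_glue Y hB
  simp only [condProb, glue_fill]
  exact measurable_measure_prodMk_left (ν := iidLaw d) (measurable_mix N hB')

/-- By Markov's inequality and the union bound, the labels in `N` can be fixed in such a way that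
none of the conditional probabilities of at most `m` events grows by more than a factor `m + 1`. -/
lemma exists_fill {d m : ℕ} {ι : Type*} (J : Finset ι) (hJ : J.card ≤ m)
    (B : ι → Set (Vertex d → unitInterval)) (hB : ∀ j ∈ J, MeasurableSet (B j))
    (Y : Vertex d → Option unitInterval) (N : Finset (Vertex d)) :
    ∃ z, ∀ j ∈ J, condProb (B j) (fill Y N z) ≤ ((m + 1 : ℕ) : ENNReal) * condProb (B j) Y := by
  set Λ : ENNReal := ((m + 1 : ℕ) : ENNReal) with hΛ
  have hΛ0 : Λ ≠ 0 := by simp [hΛ]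
  have hΛt : Λ ≠ ⊤ := by simp [hΛ]
  have hbad : ∀ j ∈ J,
      iidLaw d {z | ¬ condProb (B j) (fill Y N z) ≤ Λ * condProb (B j) Y} ≤ Λ⁻¹ := by
    intro j hj
    have hint := lintegral_condProb_fill (hB j hj) Y N
    have hmeas := measurable_condProb_fill (hB j hj) Y N
    by_cases h0 : condProb (B j) Y = 0
    · rw [h0] at hint
      rw [lintegral_eq_zero_iff hmeas] at hint
      have : ∀ᵐ z ∂(iidLaw d), condProb (B j) (fill Y N z) ≤ Λ * condProb (B j) Y := by
        filter_upwards [hint] with z hz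
        rw [hz]
        exact zero_le
      rw [ae_iff] at this
      rw [this]
      exact zero_le
    · have ht : condProb (B j) Y ≠ ⊤ := measure_ne_top _ _
      have hmk := mul_meas_ge_le_lintegral (μ := iidLaw d) hmeas (Λ * condProb (B j) Y)
      rw [hint] at hmk
      have h1 : iidLaw d {z | Λ * condProb (B j) Y ≤ condProb (B j) (fill Y N z)} ≤ Λ⁻¹ := by
        rw [← ENNReal.mul_le_mul_iff_right (a := Λ * condProb (B j) Y)
          (mul_ne_zero hΛ0 h0) (ENNReal.mul_ne_top hΛt ht)]
        refine hmk.trans (le_of_eq ?_)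
        rw [mul_right_comm, ENNReal.mul_inv_cancel hΛ0 hΛt, one_mul]
      refine (measure_mono ?_).trans h1
      intro z hz
      exact (not_le.1 hz).le
  have hunion : iidLaw d (⋃ j ∈ J, {z | ¬ condProb (B j) (fill Y N z) ≤ Λ * condProb (B j) Y})
      < 1 := by
    calc _ ≤ ∑ j ∈ J, iidLaw d {z | ¬ condProb (B j) (fill Y N z) ≤ Λ * condProb (B j) Y} :=
          measure_biUnion_finset_le _ _
      _ ≤ ∑ _j ∈ J, Λ⁻¹ := Finset.sum_le_sum hbad
      _ = (J.card : ENNReal) * Λ⁻¹ := by simp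
      _ < Λ * Λ⁻¹ := by
          refine ENNReal.mul_lt_mul_left (ENNReal.inv_ne_zero.2 hΛt) (ENNReal.inv_ne_top.2 hΛ0) ?_
          rw [hΛ]
          exact_mod_cast Nat.lt_succ_of_le hJ
      _ = 1 := ENNReal.mul_inv_cancel hΛ0 hΛt
  have hne : (⋃ j ∈ J, {z | ¬ condProb (B j) (fill Y N z) ≤ Λ * condProb (B j) Y}) ≠ Set.univ := by
    intro h
    rw [h, measure_univ] at hunion
    exact lt_irrefl _ hunion
  obtain ⟨z, hz⟩ := (Set.ne_univ_iff_exists_notMem _).1 hne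
  refine ⟨z, fun j hj => ?_⟩
  by_contra hcon
  exact hz (Set.mem_biUnion hj hcon)

lemma condProb_shift {d : ℕ} {B : Set (Vertex d → unitInterval)} (hB : MeasurableSet B)
    (p : Vertex d) (Y : Vertex d → Option unitInterval) :
    condProb B (shift p Y) = condProb (shift p ⁻¹' B) Y := by
  have hB' : MeasurableSet {y | glue (shift p Y) y ∈ B} := measurable_glue _ hB
  have h := (measurePreserving_shift (d := d) p).measure_preimage hB'.nullMeasurableSet
  rw [condProb, condProb, ← h]
  rfl

/-! ### A local version of the Lovász local lemma -/

section LocalLemma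

variable {d : ℕ} {In : Type*}

lemma condProb_congr {b : ℕ} {Bad : (Vertex d → In) → Set (Vertex d → unitInterval)}
    (hloc : ∀ x x' y y', (∀ u ∈ box d b, x u = x' u ∧ y u = y' u) → y ∈ Bad x → y' ∈ Bad x')
    {x x' : Vertex d → In} {Y Y' : Vertex d → Option unitInterval}
    (h : ∀ u ∈ box d b, x u = x' u ∧ Y u = Y' u) :
    condProb (Bad x) Y = condProb (Bad x') Y' := by
  unfold condProb
  congr 1
  ext y
  constructor
  · refine hloc x x' _ _ fun u hu => ⟨(h u hu).1, ?_⟩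
    simp [glue, (h u hu).2]
  · refine hloc x' x _ _ fun u hu => ⟨(h u hu).1.symm, ?_⟩
    simp [glue, (h u hu).2]

/-- The data that the greedy assignment of random labels works with: the colour of a vertex, whether
it is a selected vertex, its input label, and its random label as far as it is already fixed. -/
abbrev FixState (In : Type*) : Type _ := (ℕ × Prop × In) × Option unitInterval

/-- Fixing the random labels in the box of radius `r` around the origin as in `z` increases the
conditional probability of the bad event at each selected vertex nearby by a factor of at most
`9 ^ d + 1`. -/
def GoodFill (r : ℕ) (Bad : (Vertex d → In) → Set (Vertex d → unitInterval))
    (s : Vertex d → FixState In) (z : Vertex d → unitInterval) : Prop :=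
  ∀ p ∈ box d (4 * r), (s p).1.2.1 →
    condProb (Bad (shift p fun v => (s v).1.2.2)) (shift p (fill (fun v => (s v).2) (box d r) z)) ≤
      ((9 ^ d + 1 : ℕ) : ENNReal) *
        condProb (Bad (shift p fun v => (s v).1.2.2)) (shift p fun v => (s v).2)

/-- Random labels for the box of radius `r` around the origin, chosen as in `GoodFill`. -/
noncomputable def pickFill (r : ℕ) (Bad : (Vertex d → In) → Set (Vertex d → unitInterval))
    (s : Vertex d → FixState In) : Vertex d → unitInterval :=
  Classical.epsilon (GoodFill r Bad s)

/-- `v + u` is a selected vertex of colour `a`, and `v` lies in the box of radius `r` around it. -/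
def NearSelected (r a : ℕ) (s : Vertex d → FixState In) (v u : Vertex d) : Prop :=
  u ∈ box d r ∧ (s (v + u)).1.2.1 ∧ (s (v + u)).1.1 = a

open Classical in
/-- The selected vertices of colour `a` fix the random labels in the boxes around them. -/
noncomputable def fixStep (r : ℕ) (Bad : (Vertex d → In) → Set (Vertex d → unitInterval)) (a : ℕ)
    (s : Vertex d → FixState In) (v : Vertex d) : Option unitInterval :=
  if (s v).2 = none ∧ ∃ u, NearSelected r a s v u then
    some (pickFill r Bad (shift (v + Classical.epsilon (NearSelected r a s v)) s)
      (-Classical.epsilon (NearSelected r a s v)))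
  else (s v).2

variable {r : ℕ} {Bad : (Vertex d → In) → Set (Vertex d → unitInterval)}

lemma pickFill_congr
    (hloc : ∀ x x' y y', (∀ u ∈ box d (3 * r), x u = x' u ∧ y u = y' u) → y ∈ Bad x → y' ∈ Bad x')
    {s s' : Vertex d → FixState In} (h : ∀ u ∈ box d (7 * r), s u = s' u) :
    pickFill r Bad s = pickFill r Bad s' := by
  unfold pickFill
  congr 1
  funext z
  unfold GoodFill
  refine forall_congr fun p => forall_congr fun hp => ?_
  rw [h p (box_mono (by omega) hp)]
  have hpu : ∀ u ∈ box d (3 * r), s (p + u) = s' (p + u) := fun u hu =>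
    h _ (box_mono (by omega) (add_mem_box hp hu))
  have e1 : condProb (Bad (shift p fun v => (s v).1.2.2))
      (shift p (fill (fun v => (s v).2) (box d r) z)) =
      condProb (Bad (shift p fun v => (s' v).1.2.2))
        (shift p (fill (fun v => (s' v).2) (box d r) z)) :=
    condProb_congr hloc fun u hu => by simp only [shift, fill, hpu u hu, and_self]
  have e2 : condProb (Bad (shift p fun v => (s v).1.2.2)) (shift p fun v => (s v).2) =
      condProb (Bad (shift p fun v => (s' v).1.2.2)) (shift p fun v => (s' v).2) :=
    condProb_congr hloc fun u hu => by simp only [shift, hpu u hu, and_self]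
  rw [e1, e2]

lemma isLocal_fixStep
    (hloc : ∀ x x' y y', (∀ u ∈ box d (3 * r), x u = x' u ∧ y u = y' u) → y ∈ Bad x → y' ∈ Bad x')
    (a : ℕ) : IsLocal (8 * r) (fixStep r Bad a) := by
  intro s s' v v' h
  have h0 : s v = s' v' := by simpa using h 0 (zero_mem_box d _)
  have hnear : NearSelected r a s v = NearSelected r a s' v' := by
    funext u
    unfold NearSelected
    by_cases hu : u ∈ box d r
    · rw [h u (box_mono (by omega) hu)]
    · simp [hu]
  unfold fixStep
  rw [hnear, h0]
  split_ifs with hex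
  · have hmem := (Classical.epsilon_spec hex.2).1
    rw [pickFill_congr hloc]
    intro u hu
    simp only [shift]
    rw [add_assoc, add_assoc]
    exact h _ (box_mono (by omega) (add_mem_box hmem hu))
  · rfl

/-- The states of the vertices before the first random label is fixed. -/
def fixInput (r q : ℕ) (s : Vertex d → ℕ × In) (v : Vertex d) : ℕ × Prop × In :=
  ((s v).1, separated r q (fun w => (s w).1) v, (s v).2)

/-- The random labels that have been fixed after `a` steps. -/
noncomputable def fixed (r : ℕ) (Bad : (Vertex d → In) → Set (Vertex d → unitInterval)) (q a : ℕ)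
    (s : Vertex d → ℕ × In) : Vertex d → Option unitInterval :=
  sweep (fixStep r Bad) (fun _ => none) a (fixInput r q s)

lemma isLocal_fixInput (r q : ℕ) : IsLocal (r * q) (fixInput (d := d) (In := In) r q) := by
  have h1 : IsLocal (d := d) 0 (fun (s : Vertex d → ℕ × In) v => (s v).1) :=
    IsLocal.of_pointwise Prod.fst
  have h2 : IsLocal (d := d) 0 (fun (s : Vertex d → ℕ × In) v => (s v).2) :=
    IsLocal.of_pointwise Prod.snd
  exact (h1.prodMk (((isLocal_separated r q).comp h1).prodMk h2)).mono (by simp)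

lemma isLocal_fixed
    (hloc : ∀ x x' y y', (∀ u ∈ box d (3 * r), x u = x' u ∧ y u = y' u) → y ∈ Bad x → y' ∈ Bad x')
    (q a : ℕ) : IsLocal (8 * r * a + r * q) (fixed r Bad q a) :=
  (IsLocal.sweep _ (isLocal_fixStep hloc) a).comp (isLocal_fixInput r q)

lemma exists_goodFill (hr : 0 < r) (hmeas : ∀ x, MeasurableSet (Bad x))
    {s : Vertex d → FixState In}
    (hsep : ∀ p p', (s p).1.2.1 → (s p').1.2.1 → p' - p ∈ box d r → p = p') :
    ∃ z, GoodFill r Bad s z := by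
  classical
  set J := (box d (4 * r)).filter fun p => (s p).1.2.1
  have hJ : J.card ≤ 9 ^ d := card_separated_le hr J (Finset.filter_subset _ _)
    fun p hp p' hp' h => hsep p p' (Finset.mem_filter.1 hp).2 (Finset.mem_filter.1 hp').2 h
  obtain ⟨z, hz⟩ := exists_fill J hJ (fun p => shift p ⁻¹' Bad (shift p fun v => (s v).1.2.2))
    (fun p _ => measurable_shift p (hmeas _)) (fun v => (s v).2) (box d r)
  refine ⟨z, fun p hp hM => ?_⟩
  rw [condProb_shift (hmeas _), condProb_shift (hmeas _)]
  exact hz p (Finset.mem_filter.2 ⟨hp, hM⟩)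

/-- The conditional probability of the bad event at a selected vertex `p` changes in step `a` only
if there is a selected vertex of colour `a` at distance at most `4 r`. There is at most one such
vertex, as the colours of vertices at distance at most `8 r` are different. -/
lemma condProb_fixStep_le (hr : 0 < r)
    (hloc : ∀ x x' y y', (∀ u ∈ box d (3 * r), x u = x' u ∧ y u = y' u) → y ∈ Bad x → y' ∈ Bad x')
    (hmeas : ∀ x, MeasurableSet (Bad x)) {s : Vertex d → FixState In}
    (hcol : ProperAt (8 * r) fun v => (s v).1.1)
    (hsep : ∀ p p', (s p).1.2.1 → (s p').1.2.1 → p' - p ∈ box d r → p = p')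
    {p : Vertex d} (hp : (s p).1.2.1) (a : ℕ) :
    (condProb (Bad (shift p fun v => (s v).1.2.2)) (shift p (fixStep r Bad a s)) =
      condProb (Bad (shift p fun v => (s v).1.2.2)) (shift p fun v => (s v).2)) ∨
    ((∃ u ∈ box d (4 * r), (s (p + u)).1.2.1 ∧ (s (p + u)).1.1 = a) ∧
    condProb (Bad (shift p fun v => (s v).1.2.2)) (shift p (fixStep r Bad a s)) ≤
      ((9 ^ d + 1 : ℕ) : ENNReal) *
      condProb (Bad (shift p fun v => (s v).1.2.2)) (shift p fun v => (s v).2)) := by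
  by_cases hex : ∃ u ∈ box d (4 * r), (s (p + u)).1.2.1 ∧ (s (p + u)).1.1 = a
  swap
  · left
    refine condProb_congr hloc fun w hw => ⟨rfl, ?_⟩
    simp only [shift]
    unfold fixStep
    rw [if_neg]
    rintro ⟨-, u, hu, hM, ha⟩
    refine hex ⟨w + u, box_mono (by omega) (add_mem_box hw hu), ?_⟩
    rw [← add_assoc]
    exact ⟨hM, ha⟩
  · refine Or.inr ⟨hex, ?_⟩
    obtain ⟨u, hu, hM, ha⟩ := hex
    have hgood : GoodFill r Bad (shift (p + u) s) (pickFill r Bad (shift (p + u) s)) := by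
      refine Classical.epsilon_spec (exists_goodFill hr hmeas fun p₁ p₂ h₁ h₂ h => ?_)
      exact add_left_cancel (hsep (p + u + p₁) (p + u + p₂) h₁ h₂ (by simpa using h))
    have hle := hgood (-u) (neg_mem_box hu) (by simpa [shift] using hp)
    have e1 : (shift (-u) fun v => (shift (p + u) s v).1.2.2) = shift p fun v => (s v).1.2.2 := by
      funext w
      simp [shift, ← add_assoc]
    have e2 : (shift (-u) fun v => (shift (p + u) s v).2) = shift p fun v => (s v).2 := by
      funext w
      simp [shift, ← add_assoc]
    rw [e1, e2] at hle
    refine le_trans (le_of_eq (condProb_congr hloc fun w hw => ⟨rfl, ?_⟩)) hle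
    have huniq : ∀ u', NearSelected r a s (p + w) u' → u' = u - w := by
      rintro u' ⟨hu', -, ha'⟩
      have h := hcol.eq_of_sub_mem (p := p + u) (q := p + w + u')
        (by
          have h1 := sub_mem_box (add_mem_box hw hu') hu
          have h2 : p + w + u' - (p + u) = w + u' - u := by abel
          rw [h2]
          exact box_mono (by omega) h1)
        (ha.trans ha'.symm)
      have h3 : u = w + u' := by
        have : p + u = p + (w + u') := by rw [h, add_assoc]
        exact add_left_cancel this
      rw [h3]
      abel
    have hpw : p + u + (-u + w) = p + w := by abel
    simp only [shift, fixStep, fill, hpw]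
    by_cases hY : (s (p + w)).2 = none
    swap
    · simp [hY]
    by_cases hN : -u + w ∈ box d r
    · have hnear : NearSelected r a s (p + w) (u - w) := by
        refine ⟨?_, ?_, ?_⟩
        · have := neg_mem_box hN
          rwa [neg_add, neg_neg, ← sub_eq_add_neg] at this
        all_goals
          have h2 : p + w + (u - w) = p + u := by abel
          rw [h2]
          assumption
      have heps := huniq _ (Classical.epsilon_spec ⟨_, hnear⟩)
      rw [if_pos ⟨hY, _, hnear⟩, if_pos ⟨hY, hN⟩, heps]
      have h2 : p + w + (u - w) = p + u := by abel
      have h3 : -(u - w) = -u + w := by abel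
      rw [h2, h3]
    · rw [if_neg, if_neg]
      · exact fun h => hN h.2
      · rintro ⟨-, u', hu'⟩
        have h4 := huniq u' hu'
        apply hN
        have h5 := neg_mem_box hu'.1
        rw [h4] at h5
        have h3 : -(u - w) = -u + w := by abel
        rwa [h3] at h5

/-- After all steps the random labels of all vertices are fixed. -/
lemma fixed_ne_none (q : ℕ) {s : Vertex d → ℕ × In} (v : Vertex d) (hq : (s v).1 < q) :
    fixed r Bad q q s v ≠ none := by
  obtain ⟨u, hu, hM⟩ := exists_separated_near (r := r) (col := fun w => (s w).1) hq
  have hlt := separated_col_lt hM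
  have hstep : ∀ a, (s (v + u)).1 < a → fixed r Bad q a s v ≠ none := by
    intro a ha
    induction a with
    | zero => omega
    | succ a ih =>
      have hrec : fixed r Bad q (a + 1) s v =
        fixStep r Bad a (fun w => (fixInput r q s w, fixed r Bad q a s w)) v := rfl
      rw [hrec]
      unfold fixStep
      by_cases hY : fixed r Bad q a s v = none
      · have hcol : (s (v + u)).1 = a := by
          by_contra hne
          exact ih (by omega) hY
        rw [if_pos ⟨hY, u, hu, hM, hcol⟩]
        simp
      · rw [if_neg fun h => hY h.1]
        exact hY
  exact hstep q hlt

open Classical in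
lemma condProb_fixed_le (hr : 0 < r)
    (hloc : ∀ x x' y y', (∀ u ∈ box d (3 * r), x u = x' u ∧ y u = y' u) → y ∈ Bad x → y' ∈ Bad x')
    (hmeas : ∀ x, MeasurableSet (Bad x)) {c : ENNReal} (hc : ∀ x, iidLaw d (Bad x) ≤ c)
    (q : ℕ) {s : Vertex d → ℕ × In} (hcol : ProperAt (8 * r) fun v => (s v).1)
    {p : Vertex d} (hp : separated r q (fun w => (s w).1) p) (a : ℕ) :
    condProb (Bad (shift p fun v => (s v).2)) (shift p (fixed r Bad q a s)) ≤
      ((9 ^ d + 1 : ℕ) : ENNReal) ^ ((box d (4 * r)).filter fun u =>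
        separated r q (fun w => (s w).1) (p + u) ∧ (s (p + u)).1 < a).card * c := by
  have hsep : ∀ p p', separated r q (fun w => (s w).1) p → separated r q (fun w => (s w).1) p' →
      p' - p ∈ box d r → p = p' := fun p p' h h' hpp =>
    separated_eq (fun v u hu => hcol v u (box_mono (by omega) hu)) h h' hpp
  induction a with
  | zero =>
    have h0 : condProb (Bad (shift p fun v => (s v).2)) (shift p (fixed r Bad q 0 s)) =
      iidLaw d (Bad (shift p fun v => (s v).2)) := rfl
    rw [h0]
    simpa using hc _
  | succ a ih =>
    have hrec := condProb_fixStep_le hr hloc hmeas (a := a) (p := p)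
      (s := fun w => (fixInput r q s w, fixed r Bad q a s w)) hcol hsep hp
    have hsub : ((box d (4 * r)).filter fun u =>
        separated r q (fun w => (s w).1) (p + u) ∧ (s (p + u)).1 < a) ⊆
        ((box d (4 * r)).filter fun u =>
        separated r q (fun w => (s w).1) (p + u) ∧ (s (p + u)).1 < a + 1) := by
      intro u hu
      simp only [Finset.mem_filter] at hu ⊢
      exact ⟨hu.1, hu.2.1, by omega⟩
    have hone : (1 : ENNReal) ≤ ((9 ^ d + 1 : ℕ) : ENNReal) := by
      exact_mod_cast Nat.le_add_left 1 _
    rcases hrec with h | ⟨⟨u, hu, hM, ha⟩, h⟩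
    · refine (le_of_eq h).trans (ih.trans ?_)
      gcongr
    · refine h.trans ?_
      refine (mul_le_mul_right ih _).trans ?_
      rw [← mul_assoc, ← pow_succ']
      refine mul_le_mul_left (pow_le_pow_right₀ hone ?_) _
      rw [Nat.succ_le_iff]
      refine Finset.card_lt_card ((Finset.ssubset_iff_of_subset hsub).2 ⟨u, ?_, ?_⟩)
      · simp only [Finset.mem_filter]
        exact ⟨hu, hM, by rw [show (s (p + u)).1 = a from ha]; omega⟩
      · simp only [Finset.mem_filter, not_and]
        intro _ _
        rw [show (s (p + u)).1 = a from ha]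
        omega

/-- The local lemma: if the bad events have small probability, a local algorithm that is given a
colouring with finitely many colours finds labels that avoid the bad events at all vertices of the
separated set. -/
theorem exists_local_avoiding (hr : 0 < r)
    (hloc : ∀ x x' y y', (∀ u ∈ box d (3 * r), x u = x' u ∧ y u = y' u) → y ∈ Bad x → y' ∈ Bad x')
    (hmeas : ∀ x, MeasurableSet (Bad x)) {c : ENNReal} (hc : ∀ x, iidLaw d (Bad x) ≤ c)
    (hc1 : ((9 ^ d + 1 : ℕ) : ENNReal) ^ (9 ^ d) * c < 1) (q : ℕ) :
    ∃ (R : ℕ) (H : (Vertex d → ℕ × In) → Vertex d → unitInterval), IsLocal R H ∧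
      ∀ s : Vertex d → ℕ × In, (ProperAt (8 * r) fun v => (s v).1) → (∀ v, (s v).1 < q) →
        ∀ p, separated r q (fun w => (s w).1) p →
          shift p (H s) ∉ Bad (shift p fun v => (s v).2) := by
  classical
  refine ⟨_, fun s v => (fixed r Bad q q s v).getD 0,
    (IsLocal.of_pointwise fun o : Option unitInterval => o.getD 0).comp
      (isLocal_fixed hloc q q), ?_⟩
  intro s hcol hq p hp hbad
  have h := condProb_fixed_le hr hloc hmeas hc q hcol hp q
  have hcard : ((box d (4 * r)).filter fun u =>
        separated r q (fun w => (s w).1) (p + u) ∧ (s (p + u)).1 < q).card ≤ 9 ^ d := by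
    refine card_separated_le hr _ (Finset.filter_subset _ _) fun u hu u' hu' huu => ?_
    simp only [Finset.mem_filter] at hu hu'
    exact add_left_cancel (separated_eq (fun v u hu => hcol v u (box_mono (by omega) hu))
      hu.2.1 hu'.2.1 (by simpa using huu))
  have hone : (1 : ENNReal) ≤ ((9 ^ d + 1 : ℕ) : ENNReal) := by
    exact_mod_cast Nat.le_add_left 1 _
  have hlt := (h.trans (mul_le_mul_left (pow_le_pow_right₀ hone hcard) _)).trans_lt hc1
  refine hlt.ne ?_
  have hglue : ∀ y, glue (shift p (fixed r Bad q q s)) y =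
      shift p fun v => (fixed r Bad q q s v).getD 0 := by
    intro y
    funext u
    obtain ⟨b, hb⟩ := Option.ne_none_iff_exists'.1
      (fixed_ne_none (r := r) (Bad := Bad) q (p + u) (hq _))
    simp [glue, shift, hb]
  unfold condProb
  have huniv : {y | glue (shift p (fixed r Bad q q s)) y ∈ Bad (shift p fun v => (s v).2)} =
      Set.univ := by
    rw [Set.eq_univ_iff_forall]
    intro y
    rw [Set.mem_ofPred_eq, hglue]
    exact hbad
  rw [huniv, measure_univ]

end LocalLemma

/-! ### Measurability of local functions -/

lemma measurableSet_of_dependsOn {d : ℕ} {Ω α : Type*} [MeasurableSpace Ω] [Countable α] (ρ : ℕ)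
    {ξ : Ω → Vertex d → α} (hξ : ∀ u a, MeasurableSet {ω | ξ ω u = a})
    {Q : (Vertex d → α) → Prop} (hQ : ∀ κ κ', (∀ u ∈ box d ρ, κ u = κ' u) → Q κ → Q κ') :
    MeasurableSet {ω | Q (ξ ω)} := by
  have h : {ω | Q (ξ ω)} = ⋃ g ∈ {g : box d ρ → α | ∃ κ, (∀ u : box d ρ, κ u = g u) ∧ Q κ},
      ⋂ u : box d ρ, {ω | ξ ω u = g u} := by
    ext ω
    simp only [Set.mem_ofPred_eq, Set.mem_iUnion, Set.mem_iInter, exists_prop]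
    constructor
    · exact fun h => ⟨fun u => ξ ω u, ⟨_, fun u => rfl, h⟩, fun u => rfl⟩
    · rintro ⟨g, ⟨κ, hκ, hQκ⟩, hg⟩
      exact hQ κ _ (fun u hu => (hκ ⟨u, hu⟩).trans (hg ⟨u, hu⟩).symm) hQκ
  rw [h]
  exact MeasurableSet.biUnion (Set.to_countable _) fun g _ => MeasurableSet.iInter fun u => hξ _ _

/-! ### Truncated runs of a uniform algorithm -/

namespace UniformAlgorithm

variable {d : ℕ} {In Out : Type*} (A : UniformAlgorithm d In Out)

/-- The output at `v` of the algorithm, if it stops after having seen a ball of radius less than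
`n`. -/
def runBelow (x : Vertex d → In) (y : Vertex d → unitInterval) (v : Vertex d) : ℕ → Option Out
  | 0 => none
  | n + 1 => (runBelow x y v n).or (A.rule n (view x v n) (view y v n))

variable {A} {x : Vertex d → In} {y : Vertex d → unitInterval} {v : Vertex d}

lemma runBelow_eq_none {n : ℕ} :
    A.runBelow x y v n = none ↔ ∀ s < n, A.rule s (view x v s) (view y v s) = none := by
  induction n with
  | zero => simp [runBelow]
  | succ n ih => rw [runBelow, Option.or_eq_none_iff, ih, Nat.forall_lt_succ_right]

lemma outputs_of_runBelow {n : ℕ} {o : Out} (h : A.runBelow x y v n = some o) :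
    A.Outputs x y v o := by
  induction n with
  | zero => simp [runBelow] at h
  | succ n ih =>
    rw [runBelow, Option.or_eq_some_iff] at h
    rcases h with h | ⟨h1, h2⟩
    · exact ih h
    · exact ⟨n, h2, runBelow_eq_none.1 h1⟩

lemma Outputs.unique {o o' : Out} (h : A.Outputs x y v o) (h' : A.Outputs x y v o') : o = o' := by
  obtain ⟨s, hs, hs'⟩ := h
  obtain ⟨n, hn, hn'⟩ := h'
  rcases lt_trichotomy s n with hlt | rfl | hlt
  · rw [hn' s hlt] at hs
    simp at hs
  · rw [hs] at hn
    exact Option.some.inj hn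
  · rw [hs' n hlt] at hn
    simp at hn

lemma isLocal_runBelow (A : UniformAlgorithm d In Out) (n : ℕ) :
    IsLocal n fun (s : Vertex d → In × unitInterval) v =>
      A.runBelow (fun w => (s w).1) (fun w => (s w).2) v (n + 1) := by
  intro s s' v v' h
  have key : ∀ m ≤ n + 1, A.runBelow (fun w => (s w).1) (fun w => (s w).2) v m =
      A.runBelow (fun w => (s' w).1) (fun w => (s' w).2) v' m := by
    intro m hm
    induction m with
    | zero => rfl
    | succ m ih =>
      have hv : ∀ u : Ball d m, s (v + u.1) = s' (v' + u.1) := fun u =>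
        h _ (box_mono (by omega) (mem_box_of_ball u))
      have h1 : view (fun w => (s w).1) v m = view (fun w => (s' w).1) v' m := by
        funext u
        simp only [view, hv]
      have h2 : view (fun w => (s w).2) v m = view (fun w => (s' w).2) v' m := by
        funext u
        simp only [view, hv]
      rw [runBelow, runBelow, ih (by omega), h1, h2]
  exact key _ le_rfl

lemma measurableSet_runBelow (A : UniformAlgorithm d In Out) (x : Vertex d → In) (v : Vertex d)
    (n : ℕ) (o : Option Out) : MeasurableSet {y | A.runBelow x y v n = o} := by
  induction n generalizing o with
  | zero => simp [runBelow]
  | succ n ih =>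
    have hrule : ∀ o, MeasurableSet {y | A.rule n (view x v n) (view y v n) = o} := fun o =>
      (measurable_pi_lambda _ fun u => measurable_pi_apply (v + u.1) :
        Measurable fun y : Vertex d → unitInterval => view y v n)
        (A.measurable_rule n (view x v n) o)
    cases o with
    | none =>
      simp only [runBelow, Option.or_eq_none_iff]
      exact (ih none).inter (hrule none)
    | some o =>
      simp only [runBelow, Option.or_eq_some_iff]
      exact (ih _).union ((ih none).inter (hrule _))

lemma lt_codingRadius {n : ℕ} (h : A.runBelow x y 0 (n + 1) = none) :
    (n : ℕ∞) < A.codingRadius x y := by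
  rw [runBelow_eq_none] at h
  have hle : ((n + 1 : ℕ) : ℕ∞) ≤ A.codingRadius x y := by
    refine le_iInf₂ fun s hs => ?_
    have : ¬ s < n + 1 := fun hlt => hs (h s hlt)
    exact_mod_cast not_lt.1 this
  refine lt_of_lt_of_le ?_ hle
  exact_mod_cast Nat.lt_succ_self n

lemma measure_runBelow_eq_none_le {r : ℕ} {ε : ENNReal}
    (hε : ∀ x, iidLaw d {y | (r : ℕ∞) < A.codingRadius x y} ≤ ε) (x : Vertex d → In)
    (v : Vertex d) : iidLaw d {y | A.runBelow x y v (r + 1) = none} ≤ ε := by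
  have hpre : {y | A.runBelow x y v (r + 1) = none} =
      shift v ⁻¹' {y | A.runBelow (shift v x) y 0 (r + 1) = none} := by
    ext y
    have h := isLocal_runBelow A r (fun w => (x w, y w)) (fun w => (shift v x w, shift v y w)) v 0
      fun u _ => by simp [shift]
    simp only at h
    simp only [Set.mem_ofPred_eq, Set.mem_preimage]
    rw [h]
  rw [hpre, (measurePreserving_shift v).measure_preimage
    (measurableSet_runBelow A _ _ _ _).nullMeasurableSet]
  exact (measure_mono fun y hy => lt_codingRadius hy).trans (hε (shift v x))

end UniformAlgorithm

/-! ### Local solutions and their combination -/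

section Combine

variable {d t : ℕ} {In Out : Type*} (P : LCL d t In Out)

/-- The output labelling `c` is correct at the vertices that are at most `t` outside the box of
radius `r` around the origin, and extends the partial labelling `κ`. -/
def LCL.IsLocalSolution (r : ℕ) (x : Vertex d → In) (κ : Vertex d → Option Out)
    (c : Vertex d → Out) : Prop :=
  (∀ u ∈ box d (2 * r), ∀ o, κ u = some o → c u = o) ∧
    ∀ v ∈ box d (r + t), view (fun w => (x w, c w)) v t ∈ P.allowed

/-- The vertices at distance between `r + 1` and `r + 2 t` from the origin. -/
noncomputable def shell (d r t : ℕ) : Finset (Vertex d) := box d (r + 2 * t) \ box d r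

/-- The partial labelling `κ` is defined on the shell around the box of radius `r`, and extends to
a local solution. -/
def LCL.IsExtendable (r : ℕ) (x : Vertex d → In) (κ : Vertex d → Option Out) : Prop :=
  (∀ u ∈ shell d r t, κ u ≠ none) ∧ ∃ c, P.IsLocalSolution r x κ c

variable {P} {r : ℕ}

lemma LCL.IsLocalSolution.congr (ht : 2 * t ≤ r) {x x' : Vertex d → In}
    {κ κ' : Vertex d → Option Out} (hx : ∀ u ∈ box d (2 * r), x u = x' u)
    (hκ : ∀ u ∈ box d (2 * r), κ u = κ' u) {c : Vertex d → Out}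
    (h : P.IsLocalSolution r x κ c) : P.IsLocalSolution r x' κ' c := by
  refine ⟨fun u hu o ho => h.1 u hu o ((hκ u hu).trans ho), fun v hv => ?_⟩
  have hview : view (fun w => (x' w, c w)) v t = view (fun w => (x w, c w)) v t := by
    funext u
    simp only [view]
    rw [hx _ (box_mono (by omega) (add_mem_box hv (mem_box_of_ball u)))]
  rw [hview]
  exact h.2 v hv

lemma LCL.IsExtendable.congr (ht : 2 * t ≤ r) {x x' : Vertex d → In}
    {κ κ' : Vertex d → Option Out} (hx : ∀ u ∈ box d (2 * r), x u = x' u)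
    (hκ : ∀ u ∈ box d (2 * r), κ u = κ' u) (h : P.IsExtendable r x κ) :
    P.IsExtendable r x' κ' := by
  refine ⟨fun u hu => ?_, h.2.imp fun c hc => hc.congr ht hx hκ⟩
  rw [← hκ u (box_mono (by omega) (Finset.mem_sdiff.1 hu).1)]
  exact h.1 u hu

variable (P r) in
/-- The event that the algorithm, stopped after radius `r`, leaves a vertex of the shell around the
origin without an output, or that its outputs do not extend to a local solution. -/
def LCL.badEvent (A : UniformAlgorithm d In Out) (x : Vertex d → In) :
    Set (Vertex d → unitInterval) :=
  {y | ¬ P.IsExtendable r x fun v => A.runBelow x y v (r + 1)}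

lemma LCL.badEvent_congr (ht : 2 * t ≤ r) (A : UniformAlgorithm d In Out) (x x' : Vertex d → In)
    (y y' : Vertex d → unitInterval) (h : ∀ u ∈ box d (3 * r), x u = x' u ∧ y u = y' u)
    (hy : y ∈ P.badEvent r A x) : y' ∈ P.badEvent r A x' := by
  have hκ : ∀ u ∈ box d (2 * r), A.runBelow x' y' u (r + 1) = A.runBelow x y u (r + 1) := by
    intro u hu
    refine A.isLocal_runBelow r (fun w => (x' w, y' w)) (fun w => (x w, y w)) u u fun w hw => ?_
    have := h _ (box_mono (by omega) (add_mem_box hu hw))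
    exact Prod.ext this.1.symm this.2.symm
  exact fun h' => hy (h'.congr ht (fun u hu => (h u (box_mono (by omega) hu)).1.symm) hκ)

lemma LCL.measurableSet_badEvent [Finite Out] (ht : 2 * t ≤ r) (A : UniformAlgorithm d In Out)
    (x : Vertex d → In) : MeasurableSet (P.badEvent r A x) :=
  measurableSet_of_dependsOn (2 * r) (fun u o => A.measurableSet_runBelow x u (r + 1) o)
    (Q := fun κ => ¬ P.IsExtendable r x κ) fun _ _ h hκ h' =>
      hκ (h'.congr ht (fun _ _ => rfl) fun u hu => (h u hu).symm)

/-- As the algorithm solves the problem, local solutions exist almost surely, and it remains to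
bound the probability that the algorithm does not stop in the shell. -/
lemma LCL.measure_badEvent_le {A : UniformAlgorithm d In Out} (hA : A.Solves P) {ε : ENNReal}
    (hε : ∀ x, iidLaw d {y | (r : ℕ∞) < A.codingRadius x y} ≤ ε) (x : Vertex d → In) :
    iidLaw d (P.badEvent r A x) ≤ (shell d r t).card * ε := by
  have hsub : ∀ᵐ y ∂(iidLaw d), y ∈ P.badEvent r A x →
      y ∈ ⋃ u ∈ shell d r t, {y | A.runBelow x y u (r + 1) = none} := by
    filter_upwards [hA x] with y hy hbad
    obtain ⟨c, hc, hcol⟩ := hy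
    by_contra hnot
    simp only [Set.mem_iUnion, Set.mem_ofPred_eq, exists_prop, not_exists, not_and] at hnot
    exact hbad ⟨hnot, c, fun u _ o ho =>
      (hc u).unique (UniformAlgorithm.outputs_of_runBelow ho), fun v _ => hcol v⟩
  calc iidLaw d (P.badEvent r A x)
      ≤ iidLaw d (⋃ u ∈ shell d r t, {y | A.runBelow x y u (r + 1) = none}) := measure_mono_ae hsub
    _ ≤ ∑ u ∈ shell d r t, iidLaw d {y | A.runBelow x y u (r + 1) = none} :=
        measure_biUnion_finset_le _ _
    _ ≤ ∑ _u ∈ shell d r t, ε := Finset.sum_le_sum fun u _ =>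
        UniformAlgorithm.measure_runBelow_eq_none_le hε x u
    _ = (shell d r t).card * ε := by simp

/-- The colour of a vertex, whether it is selected, its input label, and its output label if that is
already determined. -/
abbrev ExtState (In Out : Type*) : Type _ := (ℕ × Prop × In) × Option Out

/-- `v + u` is the selected vertex of the least colour in the box of radius `r` around `v`. -/
def IsLeader (r : ℕ) (s : Vertex d → ExtState In Out) (v u : Vertex d) : Prop :=
  u ∈ box d r ∧ (s (v + u)).1.2.1 ∧
    ∀ u' ∈ box d r, (s (v + u')).1.2.1 → (s (v + u)).1.1 ≤ (s (v + u')).1.1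

variable (P r) in
/-- A local solution around the origin. -/
noncomputable def LCL.pickSolution [Nonempty Out] (s : Vertex d → ExtState In Out) :
    Vertex d → Out :=
  Classical.epsilon (P.IsLocalSolution r (fun w => (s w).1.2.2) fun w => (s w).2)

variable (P r) in
open Classical in
/-- Every vertex takes its output label from the local solution around its leader. -/
noncomputable def LCL.combine [Nonempty Out] (s : Vertex d → ExtState In Out) (v : Vertex d) :
    Out :=
  if ∃ u, IsLeader r s v u then
    P.pickSolution r (shift (v + Classical.epsilon (IsLeader r s v)) s)
      (-Classical.epsilon (IsLeader r s v))
  else Classical.arbitrary Out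

lemma LCL.isLocal_combine [Nonempty Out] (ht : 2 * t ≤ r) : IsLocal (3 * r) (P.combine r) := by
  intro s s' v v' h
  have hlead : IsLeader r s v = IsLeader r s' v' := by
    funext u
    unfold IsLeader
    by_cases hu : u ∈ box d r
    · rw [h u (box_mono (by omega) hu)]
      congr 3
      refine forall_congr fun u' => forall_congr fun hu' => ?_
      rw [h u' (box_mono (by omega) hu')]
    · simp [hu]
  unfold LCL.combine
  rw [hlead]
  split_ifs with hex
  · have hmem := (Classical.epsilon_spec hex).1
    have hagree : ∀ w ∈ box d (2 * r),
        shift (v + Classical.epsilon (IsLeader r s' v')) s w =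
        shift (v' + Classical.epsilon (IsLeader r s' v')) s' w := by
      intro w hw
      simp only [shift]
      rw [add_assoc, add_assoc]
      exact h _ (box_mono (by omega) (add_mem_box hmem hw))
    have hpick : P.pickSolution r (shift (v + Classical.epsilon (IsLeader r s' v')) s) =
        P.pickSolution r (shift (v' + Classical.epsilon (IsLeader r s' v')) s') := by
      unfold LCL.pickSolution
      congr 1
      funext c
      refine propext ⟨LCL.IsLocalSolution.congr ht ?_ ?_, LCL.IsLocalSolution.congr ht ?_ ?_⟩ <;>
      · intro w hw
        rw [hagree w hw]
    rw [hpick]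
  · rfl

/-- If around every selected vertex the partial labelling is defined on the shell and extends to a
local solution, then the local solutions fit together. Indeed, the undetermined vertices at distance
at most `2 t` from each other lie in the same boxes around selected vertices, since these boxes
are surrounded by shells of determined vertices. So they have the same leader. -/
lemma LCL.isColoring_combine [Nonempty Out] (ht : 2 * t ≤ r) {s : Vertex d → ExtState In Out}
    (hcol : ProperAt (2 * r) fun v => (s v).1.1)
    (hdense : ∀ v, ∃ u ∈ box d r, (s (v + u)).1.2.1)
    (hext : ∀ p, (s p).1.2.1 →
      P.IsExtendable r (shift p fun w => (s w).1.2.2) (shift p fun w => (s w).2)) :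
    P.IsColoring (fun w => (s w).1.2.2) (P.combine r s) := by
  classical
  have hsol : ∀ p, (s p).1.2.1 → P.IsLocalSolution r (shift p fun w => (s w).1.2.2)
      (shift p fun w => (s w).2) (P.pickSolution r (shift p s)) := fun p hp =>
    Classical.epsilon_spec (hext p hp).2
  -- `p` is the leader of `v`
  let Lead : Vertex d → Vertex d → Prop := fun v p => v - p ∈ box d r ∧ (s p).1.2.1 ∧
    ∀ p', v - p' ∈ box d r → (s p').1.2.1 → (s p).1.1 ≤ (s p').1.1
  have hLead : ∀ v u, IsLeader r s v u → Lead v (v + u) := by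
    intro v u hu
    refine ⟨by simpa using hu.1, hu.2.1, fun p' hp' hM => ?_⟩
    have := hu.2.2 (p' - v) (sub_mem_box_comm.1 hp')
    rw [add_sub_cancel] at this
    exact this hM
  have hex : ∀ v, ∃ u, IsLeader r s v u := by
    intro v
    have hne : ((box d r).filter fun u => (s (v + u)).1.2.1).Nonempty := by
      obtain ⟨u, hu, hM⟩ := hdense v
      exact ⟨u, Finset.mem_filter.2 ⟨hu, hM⟩⟩
    obtain ⟨u, hu, hmin⟩ := Finset.exists_min_image _ (fun u => (s (v + u)).1.1) hne
    rw [Finset.mem_filter] at hu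
    exact ⟨u, hu.1, hu.2, fun u' hu' hM => hmin u' (Finset.mem_filter.2 ⟨hu', hM⟩)⟩
  have hval : ∀ v, ∃ p, Lead v p ∧ P.combine r s v = P.pickSolution r (shift p s) (v - p) := by
    intro v
    refine ⟨_, hLead v _ (Classical.epsilon_spec (hex v)), ?_⟩
    unfold LCL.combine
    rw [if_pos (hex v)]
    congr 1
    abel
  have hLeadUniq : ∀ v p p', Lead v p → Lead v p' → p = p' := by
    intro v p p' h h'
    refine hcol.eq_of_sub_mem (by
      have := sub_mem_box h.1 h'.1
      rw [sub_sub_sub_cancel_left] at this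
      exact box_mono (by omega) this) ?_
    exact le_antisymm (h.2.2 p' h'.1 h'.2.1) (h'.2.2 p h.1 h.2.1)
  -- the local solutions agree on the determined vertices
  have hdet : ∀ u o p, (s u).2 = some o → (s p).1.2.1 → u - p ∈ box d (2 * r) →
      P.combine r s u = P.pickSolution r (shift p s) (u - p) := by
    intro u o p ho hp hup
    obtain ⟨p', hp', hv⟩ := hval u
    rw [hv, (hsol p' hp'.2.1).1 (u - p') (box_mono (by omega) hp'.1) o (by simpa [shift] using ho),
      (hsol p hp).1 (u - p) hup o (by simpa [shift] using ho)]
  have hnear : ∀ u u' p, (s u').2 = none → (s p).1.2.1 → u - p ∈ box d r →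
      u' - u ∈ box d (2 * t) → u' - p ∈ box d r := by
    intro u u' p hu' hp hup huu
    by_contra hnot
    refine (hext p hp).1 (u' - p) ?_ (by simpa [shift] using hu')
    refine Finset.mem_sdiff.2 ⟨?_, hnot⟩
    have := add_mem_box hup huu
    rwa [sub_add_sub_cancel'] at this
  intro v
  have hball : ∀ u u' : Ball d t, v + u.1 - (v + u'.1) ∈ box d (2 * t) := by
    intro u u'
    rw [add_sub_add_left_eq_sub]
    exact box_mono (by omega) (sub_mem_box (mem_box_of_ball u) (mem_box_of_ball u'))
  -- some local solution around a vertex `p` agrees with the combined one in the ball around `v`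
  obtain ⟨p, hp, hvp, hagree⟩ : ∃ p, (s p).1.2.1 ∧ v - p ∈ box d (r + t) ∧
      ∀ u : Ball d t, P.combine r s (v + u.1) = P.pickSolution r (shift p s) (v + u.1 - p) := by
    by_cases hund : ∃ u₀ : Ball d t, (s (v + u₀.1)).2 = none
    · obtain ⟨u₀, hu₀⟩ := hund
      obtain ⟨p, hp, -⟩ := hval (v + u₀.1)
      have hpt : v - p ∈ box d (r + t) := by
        have := sub_mem_box hp.1 (mem_box_of_ball u₀)
        have h2 : v + u₀.1 - p - u₀.1 = v - p := by abel
        rwa [h2] at this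
      refine ⟨p, hp.2.1, hpt, fun u => ?_⟩
      cases hu : (s (v + u.1)).2 with
      | some o =>
        refine hdet _ o p hu hp.2.1 ?_
        have := add_mem_box hpt (mem_box_of_ball u)
        have h2 : v - p + u.1 = v + u.1 - p := by abel
        rw [h2] at this
        exact box_mono (by omega) this
      | none =>
        obtain ⟨p', hp', hv⟩ := hval (v + u.1)
        have hpp : p' = p := by
          refine hLeadUniq _ _ _ hp' ⟨hnear _ _ _ hu hp.2.1 hp.1 (hball _ _), hp.2.1, ?_⟩
          exact fun p'' h1 h2 => hp.2.2 p'' (hnear _ _ _ hu₀ h2 h1 (hball _ _)) h2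
        rw [hv, hpp]
    · push Not at hund
      obtain ⟨p, hp, -⟩ := hval v
      refine ⟨p, hp.2.1, box_mono (by omega) hp.1, fun u => ?_⟩
      obtain ⟨o, ho⟩ := Option.ne_none_iff_exists'.1 (hund u)
      refine hdet _ o p ho hp.2.1 ?_
      have := add_mem_box hp.1 (mem_box_of_ball u)
      have h2 : v - p + u.1 = v + u.1 - p := by abel
      rw [h2] at this
      exact box_mono (by omega) this
  have hallowed := (hsol p hp).2 (v - p) hvp
  have hview : view (fun w => ((s w).1.2.2, P.combine r s w)) v t =
      view (fun w => (shift p (fun w => (s w).1.2.2) w, P.pickSolution r (shift p s) w))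
        (v - p) t := by
    funext u
    have h2 : v - p + u.1 = v + u.1 - p := by abel
    simp only [view, shift, h2, hagree u, add_sub_cancel]
  rw [hview]
  exact hallowed

/-- If a uniform algorithm stops at each vertex with high enough probability after radius `r`,
then a local algorithm solves the problem when it is given a colouring with finitely many
colours. -/
theorem LCL.exists_local_solver [Finite Out] [Nonempty Out] (hr : 0 < r) (ht : 2 * t ≤ r)
    {A : UniformAlgorithm d In Out} (hA : A.Solves P) {ε : ENNReal}
    (hε : ∀ x, iidLaw d {y | (r : ℕ∞) < A.codingRadius x y} ≤ ε)
    (hsmall : ((9 ^ d + 1 : ℕ) : ENNReal) ^ (9 ^ d) * ((shell d r t).card * ε) < 1) (q : ℕ) :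
    ∃ (R : ℕ) (F : (Vertex d → ℕ × In) → Vertex d → Out), IsLocal R F ∧
      ∀ s : Vertex d → ℕ × In, (ProperAt (8 * r) fun v => (s v).1) → (∀ v, (s v).1 < q) →
        P.IsColoring (fun v => (s v).2) (F s) := by
  obtain ⟨R, H, hH, hgood⟩ := exists_local_avoiding hr (P.badEvent_congr ht A)
    (P.measurableSet_badEvent ht A) (P.measure_badEvent_le hA hε) hsmall q
  let K : (Vertex d → ℕ × In) → Vertex d → Option Out := fun s v =>
    A.runBelow (fun w => (s w).2) (H s) v (r + 1)
  have hK : IsLocal (r + max 0 R) K :=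
    (A.isLocal_runBelow r).comp ((IsLocal.of_pointwise Prod.snd).prodMk hH)
  refine ⟨_, fun s => P.combine r fun v => (fixInput r q s v, K s v),
    (P.isLocal_combine ht).comp ((isLocal_fixInput r q).prodMk hK), fun s hcol hq => ?_⟩
  refine P.isColoring_combine (s := fun v => (fixInput r q s v, K s v)) ht ?_ ?_ ?_
  · exact fun v u hu => hcol v u (box_mono (by omega) hu)
  · exact fun v => exists_separated_near (hq v)
  · intro p hp
    have h := not_not.1 (hgood s hcol hq p hp)
    have hKp : shift p (K s) =
        fun v => A.runBelow (shift p fun w => (s w).2) (shift p (H s)) v (r + 1) := by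
      funext v
      exact ((A.isLocal_runBelow r).shift_eq (fun w => ((s w).2, H s w)) p v).symm
    change P.IsExtendable r (shift p fun w => (s w).2) (shift p (K s))
    rw [hKp]
    exact h

end Combine

/-! ### Cole–Vishkin colour reduction -/

/-- The least position in which the binary expansions of `a` and `b` differ. -/
noncomputable def firstDiff (a b : ℕ) : ℕ := sInf {i | a.testBit i ≠ b.testBit i}

lemma exists_testBit_ne {a b : ℕ} (h : a ≠ b) : {i | a.testBit i ≠ b.testBit i}.Nonempty := by
  by_contra hne
  refine h (Nat.eq_of_testBit_eq fun i => ?_)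
  by_contra hi
  exact hne ⟨i, hi⟩

lemma testBit_firstDiff_ne {a b : ℕ} (h : a ≠ b) :
    a.testBit (firstDiff a b) ≠ b.testBit (firstDiff a b) := Nat.sInf_mem (exists_testBit_ne h)

lemma firstDiff_lt {a b m : ℕ} (h : a ≠ b) (ha : a < 2 ^ m) (hb : b < 2 ^ m) :
    firstDiff a b < m := by
  by_contra hle
  refine testBit_firstDiff_ne h ?_
  have hpow : 2 ^ m ≤ 2 ^ firstDiff a b := Nat.pow_le_pow_right (by norm_num) (by omega)
  rw [Nat.testBit_eq_false_of_lt (ha.trans_le hpow), Nat.testBit_eq_false_of_lt (hb.trans_le hpow)]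

/-- The new colour of a vertex of colour `a` whose successor has colour `b`: the first position at
which the colours differ, together with the bit of `a` at this position. -/
noncomputable def cvValue (a b : ℕ) : ℕ :=
  2 * firstDiff a b + (a.testBit (firstDiff a b)).toNat

/-- The reduction step for partial colourings. A vertex without a coloured successor behaves as if
the colour of its successor differed from its own colour in the lowest bit. -/
noncomputable def cvStep : Option ℕ → Option ℕ → Option ℕ
  | none, _ => none
  | some a, none => some (a.testBit 0).toNat
  | some a, some b => some (cvValue a b)

lemma cvStep_ne {a b : ℕ} {c : Option ℕ} (hab : a ≠ b) (hbc : ∀ c', c = some c' → b ≠ c')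
    {a' b' : ℕ} (ha' : cvStep (some a) (some b) = some a') (hb' : cvStep (some b) c = some b') :
    a' ≠ b' := by
  have hbit := testBit_firstDiff_ne hab
  cases c with
  | none =>
    simp only [cvStep, Option.some.injEq, cvValue] at ha' hb'
    intro h
    rw [← ha', ← hb'] at h
    have h1 : firstDiff a b = 0 := by
      have := Bool.toNat_le (b.testBit 0)
      omega
    rw [h1] at h hbit
    have h2 : (a.testBit 0).toNat = (b.testBit 0).toNat := by omega
    revert hbit h2
    cases a.testBit 0 <;> cases b.testBit 0 <;> simp
  | some c =>
    simp only [cvStep, Option.some.injEq, cvValue] at ha' hb'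
    intro h
    rw [← ha', ← hb'] at h
    have h1 : firstDiff a b = firstDiff b c := by
      have := Bool.toNat_le (a.testBit (firstDiff a b))
      have := Bool.toNat_le (b.testBit (firstDiff b c))
      omega
    rw [← h1] at h
    have h2 : (a.testBit (firstDiff a b)).toNat = (b.testBit (firstDiff a b)).toNat := by omega
    revert hbit h2
    cases a.testBit (firstDiff a b) <;> cases b.testBit (firstDiff a b) <;> simp

section Reduce

variable {d : ℕ}

/-- One reduction step along the paths `v, v + u, v + 2 u, ...`. -/
noncomputable def reduceAlong (u : Vertex d) (ξ : Vertex d → Option ℕ) (v : Vertex d) : Option ℕ :=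
  cvStep (ξ v) (ξ (v + u))

/-- Coloured vertices that differ by `u` have different colours. -/
def ProperAlong (u : Vertex d) (ξ : Vertex d → Option ℕ) : Prop :=
  ∀ v a b, ξ v = some a → ξ (v + u) = some b → a ≠ b

variable {u : Vertex d} {ξ : Vertex d → Option ℕ}

lemma reduceAlong_eq_none {v : Vertex d} : reduceAlong u ξ v = none ↔ ξ v = none := by
  unfold reduceAlong
  cases ξ v <;> cases ξ (v + u) <;> simp [cvStep]

lemma ProperAlong.reduceAlong (h : ProperAlong u ξ) : ProperAlong u (reduceAlong u ξ) := by
  intro v a' b' ha' hb'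
  cases h1 : ξ v with
  | none => simp [GridLCL.reduceAlong, h1, cvStep] at ha'
  | some a =>
    cases h2 : ξ (v + u) with
    | none => simp [GridLCL.reduceAlong, h2, cvStep] at hb'
    | some b =>
      rw [GridLCL.reduceAlong, h1, h2] at ha'
      rw [GridLCL.reduceAlong, h2] at hb'
      exact cvStep_ne (h v a b h1 h2) (fun c' hc' => h (v + u) b c' h2 hc') ha' hb'

lemma reduceAlong_lt {m : ℕ} (hm : 1 ≤ m) (h : ProperAlong u ξ)
    (hlt : ∀ v a, ξ v = some a → a < 2 ^ m) (v : Vertex d) (a : ℕ)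
    (ha : reduceAlong u ξ v = some a) : a < 2 * m := by
  unfold reduceAlong at ha
  cases h1 : ξ v with
  | none => simp [h1, cvStep] at ha
  | some b =>
    cases h2 : ξ (v + u) with
    | none =>
      simp only [h1, h2, cvStep, Option.some.injEq] at ha
      have := Bool.toNat_le (b.testBit 0)
      omega
    | some c =>
      simp only [h1, h2, cvStep, Option.some.injEq, cvValue] at ha
      have := Bool.toNat_le (b.testBit (firstDiff b c))
      have := firstDiff_lt (h v b c h1 h2) (hlt _ _ h1) (hlt _ _ h2)
      omega

/-- A number of colours that is reduced to `8` in `j` steps. -/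
def cvBound : ℕ → ℕ
  | 0 => 8
  | j + 1 => 2 ^ (cvBound j / 2)

lemma one_le_tower (j : ℕ) : 1 ≤ tower j := by
  cases j with
  | zero => exact le_rfl
  | succ j => exact Nat.one_le_two_pow

lemma four_mul_tower_le_cvBound (j : ℕ) : 4 * tower j ≤ cvBound j := by
  induction j with
  | zero => simp [tower, cvBound]
  | succ j ih =>
    cases j with
    | zero => norm_num [tower, cvBound]
    | succ j =>
      have h1 := one_le_tower j
      have h2 : 2 ≤ tower (j + 1) := by
        calc 2 = 2 ^ 1 := rfl
          _ ≤ 2 ^ tower j := Nat.pow_le_pow_right (by norm_num) h1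
      calc 4 * tower (j + 1 + 1) = 2 ^ (2 + tower (j + 1)) := by rw [pow_add]; rfl
        _ ≤ 2 ^ (cvBound (j + 1) / 2) := Nat.pow_le_pow_right (by norm_num) (by omega)

lemma reduceAlong_iterate {j : ℕ} (h : ProperAlong u ξ)
    (hlt : ∀ v a, ξ v = some a → a < cvBound j) :
    ProperAlong u ((reduceAlong u)^[j] ξ) ∧
      ∀ v a, (reduceAlong u)^[j] ξ v = some a → a < 8 := by
  induction j generalizing ξ with
  | zero => exact ⟨h, hlt⟩
  | succ j ih =>
    have hb : 4 ≤ cvBound j := by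
      have := four_mul_tower_le_cvBound j
      have := one_le_tower j
      omega
    refine ih h.reduceAlong fun v a ha => ?_
    have := reduceAlong_lt (m := cvBound j / 2) (by omega) h hlt v a ha
    omega

lemma reduceAlong_iterate_eq_none {v : Vertex d} (j : ℕ) :
    (reduceAlong u)^[j] ξ v = none ↔ ξ v = none := by
  induction j generalizing ξ with
  | zero => rfl
  | succ j ih => rw [Function.iterate_succ_apply, ih, reduceAlong_eq_none]

lemma isLocal_reduceAlong {k : ℕ} (hu : u ∈ box d k) : IsLocal k (reduceAlong u) := by
  intro x x' v v' h
  have h0 : x v = x' v' := by simpa using h 0 (zero_mem_box d k)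
  rw [reduceAlong, reduceAlong, h0, h u hu]

/-- Coloured vertices of sup distance at most `k` have different colours. -/
def PartialProper (k : ℕ) (ξ : Vertex d → Option ℕ) : Prop :=
  ∀ u ∈ box d k, u ≠ 0 → ProperAlong u ξ

/-- The number of colours that are left after the colours have been reduced along all vectors of
sup norm at most `k`. -/
noncomputable def cvPalette (d k : ℕ) : ℕ := Fintype.card (box d k → Fin 8)

/-- Reduce the colours along each vector of sup norm at most `k` separately. The combination of the
results is the new colour. -/
noncomputable def reduceAll (k j : ℕ) (ξ : Vertex d → Option ℕ) (v : Vertex d) : Option ℕ :=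
  (ξ v).map fun _ => (Fintype.equivFin (box d k → Fin 8) fun u =>
    Fin.ofNat 8 (((reduceAlong u.1)^[j] ξ v).getD 0) : ℕ)

lemma reduceAll_lt {k j : ℕ} {v : Vertex d} {a : ℕ} (h : reduceAll k j ξ v = some a) :
    a < cvPalette d k := by
  rw [reduceAll, Option.map_eq_some_iff] at h
  obtain ⟨_, _, rfl⟩ := h
  exact Fin.is_lt _

lemma isLocal_reduceAll (k j : ℕ) : IsLocal (k * j) (reduceAll (d := d) k j) := by
  intro x x' v v' h
  have h0 : x v = x' v' := by simpa using h 0 (zero_mem_box d _)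
  unfold reduceAll
  rw [h0]
  congr 1
  funext _
  have : ∀ u : box d k, (reduceAlong u.1)^[j] x v = (reduceAlong u.1)^[j] x' v' := fun u =>
    (isLocal_reduceAlong u.2).iterate j x x' v v' h
  simp only [this]

lemma PartialProper.reduceAll {k j : ℕ} (h : PartialProper k ξ)
    (hlt : ∀ v a, ξ v = some a → a < cvBound j) : PartialProper k (reduceAll k j ξ) := by
  intro u hu hu0 v a b ha hb hab
  obtain ⟨hproper, hlt8⟩ := reduceAlong_iterate (h u hu hu0) hlt
  rw [GridLCL.reduceAll, Option.map_eq_some_iff] at ha hb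
  obtain ⟨a', ha', rfl⟩ := ha
  obtain ⟨b', hb', rfl⟩ := hb
  have heq := congrFun ((Fintype.equivFin (box d k → Fin 8)).injective (Fin.val_injective hab))
    ⟨u, hu⟩
  simp only at heq
  have hne : ∀ w c, ξ w = some c → (reduceAlong u)^[j] ξ w ≠ none := fun w c hc hn => by
    rw [reduceAlong_iterate_eq_none, hc] at hn
    simp at hn
  obtain ⟨α, hα⟩ := Option.ne_none_iff_exists'.1 (hne v a' ha')
  obtain ⟨β, hβ⟩ := Option.ne_none_iff_exists'.1 (hne (v + u) b' hb')
  have hα8 := hlt8 v α hα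
  have hβ8 := hlt8 _ β hβ
  rw [hα, hβ, Option.getD_some, Option.getD_some] at heq
  have hval := congrArg Fin.val heq
  simp only [Fin.ofNat, Nat.mod_eq_of_lt hα8, Nat.mod_eq_of_lt hβ8] at hval
  exact hproper v α β hα hβ hval

/-! ### Greedy extension of partial colourings -/

/-- One step of the greedy extension of a partial colouring. The state of a vertex consists of its
colour in the original colouring, its auxiliary colour, and its colour in the extended colouring.
The uncoloured vertices of auxiliary colour `a` choose the least free colour. -/
noncomputable def extendStep (k a : ℕ) (s : Vertex d → (Option ℕ × Option ℕ) × Option ℕ)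
    (v : Vertex d) : Option ℕ :=
  if (s v).2 = none ∧ (s v).1.2 = some a then
    some (sInf {c | ∀ u ∈ box d k, (s (v + u)).2 ≠ some c})
  else (s v).2

/-- Extend a partial colouring greedily to the vertices that have one of the first `q` auxiliary
colours. -/
noncomputable def extend (k q : ℕ) : (Vertex d → Option ℕ × Option ℕ) → Vertex d → Option ℕ :=
  sweep (extendStep k) Prod.fst q

lemma isLocal_extendStep (k a : ℕ) : IsLocal k (extendStep (d := d) k a) := by
  intro x x' v v' h
  have h0 : x v = x' v' := by simpa using h 0 (zero_mem_box d k)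
  unfold extendStep
  rw [h0]
  have hset : {c | ∀ u ∈ box d k, (x (v + u)).2 ≠ some c} =
      {c | ∀ u ∈ box d k, (x' (v' + u)).2 ≠ some c} := by
    ext c
    refine forall_congr' fun u => forall_congr' fun hu => ?_
    rw [h u hu]
  rw [hset]

lemma isLocal_extend (k q : ℕ) : IsLocal (k * q) (extend (d := d) k q) :=
  IsLocal.sweep _ (isLocal_extendStep k) q

lemma exists_free (k : ℕ) (ξ : Vertex d → Option ℕ) :
    ∃ c ≤ (box d k).card, ∀ u ∈ box d k, ξ u ≠ some c := by
  by_contra! hcon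
  have hle := Finset.card_le_card_of_surjOn (s := box d k)
    (t := (Finset.range ((box d k).card + 1)).image some) ξ (by
      intro o ho
      simp only [Finset.coe_image, Set.mem_image, Finset.mem_coe, Finset.mem_range] at ho
      obtain ⟨c, hc, rfl⟩ := ho
      obtain ⟨u, hu, hξ⟩ := hcon c (by omega)
      exact ⟨u, hu, hξ⟩)
  rw [Finset.card_image_of_injective _ (Option.some_injective ℕ), Finset.card_range] at hle
  omega

variable {s : Vertex d → Option ℕ × Option ℕ} {k q : ℕ}

lemma extend_succ (v : Vertex d) : extend k (q + 1) s v =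
    if extend k q s v = none ∧ (s v).2 = some q then
      some (sInf {c | ∀ u ∈ box d k, extend k q s (v + u) ≠ some c})
    else extend k q s v := rfl

lemma extend_succ_eq_some {v : Vertex d} {c : ℕ} (h : extend k (q + 1) s v = some c) :
    extend k q s v = some c ∨ ((s v).2 = some q ∧ c ≤ (box d k).card ∧
      ∀ u ∈ box d k, extend k q s (v + u) ≠ some c) := by
  rw [extend_succ] at h
  split_ifs at h with h1
  · right
    obtain ⟨c', hc', hfree⟩ := exists_free k fun u => extend k q s (v + u)
    rw [Option.some.injEq] at h
    have hmem : c ∈ {c | ∀ u ∈ box d k, extend k q s (v + u) ≠ some c} := by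
      rw [← h]
      exact Nat.sInf_mem ⟨c', hfree⟩
    refine ⟨h1.2, ?_, hmem⟩
    rw [← h]
    have hmem' : c' ∈ {c | ∀ u ∈ box d k, extend k q s (v + u) ≠ some c} := hfree
    exact (Nat.sInf_le hmem').trans hc'
  · exact Or.inl h

lemma extend_eq_of_fst {v : Vertex d} {c : ℕ} (h : (s v).1 = some c) :
    extend k q s v = some c := by
  induction q with
  | zero => exact h
  | succ q ih =>
    rw [extend_succ, if_neg, ih]
    rw [ih]
    simp

lemma extend_ne_none {v : Vertex d} {a : ℕ} (h : (s v).2 = some a) (ha : a < q) :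
    extend k q s v ≠ none := by
  induction q with
  | zero => omega
  | succ q ih =>
    rw [extend_succ]
    split_ifs with h1
    · simp
    · intro hn
      rcases Nat.lt_succ_iff_lt_or_eq.1 ha with h2 | h2
      · exact ih h2 hn
      · exact h1 ⟨hn, h2 ▸ h⟩

lemma extend_le (h : ∀ v c, (s v).1 = some c → c ≤ (box d k).card) {v : Vertex d} {c : ℕ}
    (hc : extend k q s v = some c) : c ≤ (box d k).card := by
  induction q with
  | zero => exact h v c hc
  | succ q ih =>
    rcases extend_succ_eq_some hc with h1 | h1
    · exact ih h1
    · exact h1.2.1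

lemma PartialProper.extend (h1 : PartialProper k fun v => (s v).1)
    (h2 : PartialProper k fun v => (s v).2) : PartialProper k (extend k q s) := by
  induction q with
  | zero => exact h1
  | succ q ih =>
    intro u hu hu0 v a b ha hb hab
    rcases extend_succ_eq_some ha with ha | ha <;> rcases extend_succ_eq_some hb with hb | hb
    · exact ih u hu hu0 v a b ha hb hab
    · refine hb.2.2 (-u) (neg_mem_box hu) ?_
      rw [add_neg_cancel_right, ha, hab]
    · refine ha.2.2 u hu ?_
      rw [hb, hab]
    · exact h2 u hu hu0 v q q ha.1 hb.1 rfl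

end Reduce

/-! ### A colouring from random labels -/

section RandomColoring

lemma measurableSet_of_isLocal {d : ℕ} {Ω α β : Type*} [MeasurableSpace Ω] [Countable α] {ρ : ℕ}
    {G : (Vertex d → α) → Vertex d → β} (hG : IsLocal ρ G) {ξ : Ω → Vertex d → α}
    (hξ : ∀ u a, MeasurableSet {ω | ξ ω u = a}) (v : Vertex d) (b : β) :
    MeasurableSet {ω | G (ξ ω) v = b} := by
  have h : {ω | G (ξ ω) v = b} = {ω | G (shift v (ξ ω)) 0 = b} := by
    ext ω
    rw [Set.mem_ofPred_eq, Set.mem_ofPred_eq, hG.shift_eq, add_zero]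
  rw [h]
  refine measurableSet_of_dependsOn ρ (ξ := fun ω => shift v (ξ ω)) (fun u a => hξ (v + u) a)
    (Q := fun κ => G κ 0 = b) fun κ κ' hκ hb => ?_
  rw [← hb]
  exact (hG κ κ' 0 0 fun u hu => by simpa using hκ u hu).symm

/-- The index of the interval `[m / N, (m + 1) / N)` that contains the random label. -/
noncomputable def discretize (N : ℕ) (y : unitInterval) : ℕ := ⌊(N : ℝ) * y⌋₊

lemma discretize_le (N : ℕ) (y : unitInterval) : discretize N y ≤ N := by
  refine Nat.floor_le_of_le ?_
  exact mul_le_of_le_one_right (Nat.cast_nonneg N) y.2.2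

lemma measurable_discretize (N : ℕ) : Measurable (discretize N) := by
  unfold discretize
  fun_prop

lemma volume_discretize_le {N : ℕ} (hN : 0 < N) (m : ℕ) :
    volume {y | discretize N y = m} ≤ (N : ENNReal)⁻¹ := by
  have hN' : (0 : ℝ) < N := by exact_mod_cast hN
  rw [unitInterval.volume_apply]
  calc volume (Subtype.val '' {y | discretize N y = m})
      ≤ volume (Set.Icc ((m : ℝ) / N) ((m + 1) / N)) := by
        refine measure_mono ?_
        rintro _ ⟨y, hy, rfl⟩
        have hy : ⌊(N : ℝ) * y⌋₊ = m := hy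
        have h0 : (0 : ℝ) ≤ (N : ℝ) * y := mul_nonneg hN'.le y.2.1
        have h1 := Nat.floor_le h0
        have h2 := Nat.lt_floor_add_one ((N : ℝ) * y)
        rw [hy] at h1 h2
        constructor
        · rw [div_le_iff₀ hN']
          linarith
        · rw [le_div_iff₀ hN']
          linarith
    _ = (N : ENNReal)⁻¹ := by
        rw [Real.volume_Icc, ← sub_div, add_sub_cancel_left, one_div, ENNReal.ofReal_inv_of_pos hN',
          ENNReal.ofReal_natCast]

lemma measure_collision_le {d N : ℕ} (hN : 0 < N) {v w : Vertex d} (hvw : v ≠ w) :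
    iidLaw d {y | discretize N (y v) = discretize N (y w)} ≤ 2 * (N : ENNReal)⁻¹ := by
  have hN0 : (N : ENNReal) ≠ 0 := by simpa using hN.ne'
  have hset : ∀ m, MeasurableSet {y : unitInterval | discretize N y = m} := fun m =>
    measurable_discretize N (measurableSet_singleton m)
  calc iidLaw d {y | discretize N (y v) = discretize N (y w)}
      ≤ iidLaw d (⋃ m ∈ Finset.range (N + 1), Set.pi (({v, w} : Finset (Vertex d)) : Set (Vertex d))
          fun _ => {y : unitInterval | discretize N y = m}) := by
        refine measure_mono fun y hy => ?_
        simp only [Set.mem_iUnion, Finset.mem_range, exists_prop]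
        refine ⟨discretize N (y v), Nat.lt_succ_of_le (discretize_le N _), ?_⟩
        intro u hu
        have hy : discretize N (y v) = discretize N (y w) := hy
        simp only [Finset.coe_insert, Finset.coe_singleton, Set.mem_insert_iff,
          Set.mem_singleton_iff] at hu
        rcases hu with rfl | rfl
        · rfl
        · exact hy.symm
    _ ≤ ∑ m ∈ Finset.range (N + 1), iidLaw d
          (Set.pi (({v, w} : Finset (Vertex d)) : Set (Vertex d))
            fun _ => {y : unitInterval | discretize N y = m}) := measure_biUnion_finset_le _ _
    _ ≤ ∑ _m ∈ Finset.range (N + 1), (N : ENNReal)⁻¹ * (N : ENNReal)⁻¹ := by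
        refine Finset.sum_le_sum fun m _ => ?_
        rw [iidLaw, Measure.infinitePi_pi _ fun i _ => hset m, Finset.prod_pair hvw]
        exact mul_le_mul' (volume_discretize_le hN m) (volume_discretize_le hN m)
    _ = ((N + 1 : ℕ) : ENNReal) * (N : ENNReal)⁻¹ * (N : ENNReal)⁻¹ := by
        rw [Finset.sum_const, Finset.card_range, nsmul_eq_mul, mul_assoc]
    _ ≤ ((2 * N : ℕ) : ENNReal) * (N : ENNReal)⁻¹ * (N : ENNReal)⁻¹ := by
        gcongr
        omega
    _ = 2 * (N : ENNReal)⁻¹ := by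
        rw [Nat.cast_mul, mul_assoc (((2 : ℕ) : ENNReal)),
          ENNReal.mul_inv_cancel hN0 (ENNReal.natCast_ne_top N)]
        simp

open Classical in
/-- Keep the label of a vertex as its colour if no vertex at sup distance at most `k` has the same
label. -/
noncomputable def distinctPart {d : ℕ} (k : ℕ) (a : Vertex d → ℕ) (v : Vertex d) : Option ℕ :=
  if ∀ u ∈ box d k, u ≠ 0 → a v ≠ a (v + u) then some (a v) else none

variable {d k : ℕ}

lemma isLocal_distinctPart : IsLocal k (distinctPart (d := d) k) := by
  intro x x' v v' h
  have h0 : x v = x' v' := by simpa using h 0 (zero_mem_box d k)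
  unfold distinctPart
  rw [h0]
  have hiff : (∀ u ∈ box d k, u ≠ 0 → x' v' ≠ x (v + u)) ↔
      ∀ u ∈ box d k, u ≠ 0 → x' v' ≠ x' (v' + u) := by
    refine forall_congr' fun u => forall_congr' fun hu => ?_
    rw [h u hu]
  simp only [hiff]

lemma distinctPart_eq_some {a : Vertex d → ℕ} {v : Vertex d} {c : ℕ}
    (h : distinctPart k a v = some c) : a v = c ∧ ∀ u ∈ box d k, u ≠ 0 → a v ≠ a (v + u) := by
  unfold distinctPart at h
  split_ifs at h with h1
  exact ⟨Option.some.inj h, h1⟩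

lemma partialProper_distinctPart (a : Vertex d → ℕ) : PartialProper k (distinctPart k a) := by
  intro u hu hu0 v b c hb hc hbc
  obtain ⟨h1, h2⟩ := distinctPart_eq_some hb
  obtain ⟨h3, -⟩ := distinctPart_eq_some hc
  exact h2 u hu hu0 (by rw [h1, h3, hbc])

/-- The colouring that is obtained from the random labels, rounded to `tower j` values, by `j`
steps of colour reduction. -/
noncomputable def auxColor (k j : ℕ) (y : Vertex d → unitInterval) : Vertex d → Option ℕ :=
  reduceAll k j (distinctPart k fun v => discretize (tower j) (y v))

/-- The partial colouring that is computed from the random labels in the first `i` stages. The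
radius of stage `i` is of order `2 ^ i`, so that the last stage dominates the sum of the radii. -/
noncomputable def stage (k : ℕ) : ℕ → (Vertex d → unitInterval) → Vertex d → Option ℕ
  | 0 => fun _ _ => none
  | i + 1 => fun y => extend k (cvPalette d k) fun v => (stage k i y v, auxColor k (2 ^ i) y v)

lemma isLocal_auxColor (j : ℕ) : IsLocal (k * j + k) (auxColor (d := d) k j) := by
  have h : IsLocal (k + 0) fun y : Vertex d → unitInterval =>
      distinctPart k fun v => discretize (tower j) (y v) :=
    isLocal_distinctPart.comp (IsLocal.of_pointwise (discretize (tower j)))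
  exact (isLocal_reduceAll k j).comp h

lemma isLocal_stage (i : ℕ) :
    IsLocal (k * (cvPalette d k + 2) * 2 ^ i) (stage (d := d) k i) := by
  induction i with
  | zero => exact fun _ _ _ _ _ => rfl
  | succ i ih =>
    refine ((isLocal_extend k (cvPalette d k)).comp (ih.prodMk (isLocal_auxColor (2 ^ i)))).mono ?_
    have h2 : 1 ≤ 2 ^ i := Nat.one_le_two_pow
    have h3 := Nat.mul_le_mul_left k h2
    have h4 := Nat.mul_le_mul_left (k * cvPalette d k) h2
    have h5 : k * (cvPalette d k + 2) * 2 ^ i =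
        k * cvPalette d k * 2 ^ i + 2 * (k * 2 ^ i) := by ring
    have h6 : k * (cvPalette d k + 2) * 2 ^ (i + 1) =
        2 * (k * cvPalette d k * 2 ^ i) + 4 * (k * 2 ^ i) := by ring
    rw [h5, h6, max_eq_left (by omega)]
    omega

lemma partialProper_auxColor (j : ℕ) (y : Vertex d → unitInterval) :
    PartialProper k (auxColor k j y) := by
  refine (partialProper_distinctPart _).reduceAll fun v a ha => ?_
  have h1 := discretize_le (tower j) (y v)
  rw [(distinctPart_eq_some ha).1] at h1
  have h2 := four_mul_tower_le_cvBound j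
  have h3 := one_le_tower j
  omega

lemma measurableSet_auxColor (j : ℕ) (v : Vertex d) (o : Option ℕ) :
    MeasurableSet {y : Vertex d → unitInterval | auxColor k j y v = o} := by
  have hG : IsLocal (k * j + k) fun a : Vertex d → ℕ => reduceAll k j (distinctPart k a) :=
    (isLocal_reduceAll k j).comp isLocal_distinctPart
  have hξ : ∀ (u : Vertex d) (a : ℕ),
      MeasurableSet {y : Vertex d → unitInterval | discretize (tower j) (y u) = a} := fun u a =>
    ((measurable_discretize (tower j)).comp (measurable_pi_apply u)) (measurableSet_singleton a)
  exact measurableSet_of_isLocal hG hξ v o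

lemma auxColor_ne_none {j : ℕ} {y : Vertex d → unitInterval} {v : Vertex d}
    (h : ∀ u ∈ box d k, u ≠ 0 →
      discretize (tower j) (y v) ≠ discretize (tower j) (y (v + u))) : auxColor k j y v ≠ none := by
  unfold auxColor reduceAll distinctPart
  rw [Ne, Option.map_eq_none_iff, if_pos h]
  simp

lemma partialProper_stage (i : ℕ) (y : Vertex d → unitInterval) :
    PartialProper k (stage k i y) := by
  induction i with
  | zero => exact fun u _ _ v a b ha _ => by simp [stage] at ha
  | succ i ih => exact PartialProper.extend ih (partialProper_auxColor (2 ^ i) y)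

lemma stage_le {i : ℕ} {y : Vertex d → unitInterval} {v : Vertex d} {c : ℕ}
    (h : stage k i y v = some c) : c ≤ (box d k).card := by
  induction i generalizing v c with
  | zero => simp [stage] at h
  | succ i ih =>
    exact extend_le (s := fun v => (stage k i y v, auxColor k (2 ^ i) y v))
      (fun v c hc => ih hc) h

lemma stage_mono {i j : ℕ} (hij : i ≤ j) {y : Vertex d → unitInterval} {v : Vertex d} {c : ℕ}
    (h : stage k i y v = some c) : stage k j y v = some c := by
  induction j, hij using Nat.le_induction with
  | base => exact h
  | succ j _ ih => exact extend_eq_of_fst (s := fun v => (stage k j y v, auxColor k (2 ^ j) y v)) ih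

lemma measurableSet_stage (i : ℕ) (v : Vertex d) (o : Option ℕ) :
    MeasurableSet {y | stage k i y v = o} := by
  induction i generalizing v o with
  | zero => simp [stage]
  | succ i ih =>
    refine measurableSet_of_isLocal (isLocal_extend k (cvPalette d k))
      (ξ := fun y v => (stage k i y v, auxColor k (2 ^ i) y v)) (fun u a => ?_) v o
    have : {y : Vertex d → unitInterval | (stage k i y u, auxColor k (2 ^ i) y u) = a} =
        {y | stage k i y u = a.1} ∩ {y | auxColor k (2 ^ i) y u = a.2} := by
      ext y
      simp [Prod.ext_iff]
    rw [this]
    exact (ih u a.1).inter (measurableSet_auxColor (2 ^ i) u a.2)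

/-- A vertex remains uncoloured only if its rounded label occurs twice in its neighbourhood. -/
lemma measure_stage_eq_none_le (i : ℕ) (v : Vertex d) :
    iidLaw d {y | stage k (i + 1) y v = none} ≤
      (box d k).card * (2 * (tower (2 ^ i) : ENNReal)⁻¹) := by
  calc iidLaw d {y | stage k (i + 1) y v = none}
      ≤ iidLaw d (⋃ u ∈ (box d k).filter (· ≠ 0), {y | discretize (tower (2 ^ i)) (y v) =
          discretize (tower (2 ^ i)) (y (v + u))}) := by
        refine measure_mono fun y hy => ?_
        by_contra hnot
        simp only [Set.mem_iUnion, Set.mem_ofPred_eq, exists_prop, not_exists, not_and,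
          Finset.mem_filter, and_imp] at hnot
        obtain ⟨a, ha⟩ := Option.ne_none_iff_exists'.1 (auxColor_ne_none hnot)
        exact extend_ne_none (s := fun v => (stage k i y v, auxColor k (2 ^ i) y v)) ha
          (reduceAll_lt ha) hy
    _ ≤ ∑ u ∈ (box d k).filter (· ≠ 0), iidLaw d {y | discretize (tower (2 ^ i)) (y v) =
          discretize (tower (2 ^ i)) (y (v + u))} := measure_biUnion_finset_le _ _
    _ ≤ ∑ _u ∈ (box d k).filter (· ≠ 0), 2 * (tower (2 ^ i) : ENNReal)⁻¹ := by
        refine Finset.sum_le_sum fun u hu => measure_collision_le (one_le_tower _) ?_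
        simpa using (Finset.mem_filter.1 hu).2
    _ = (((box d k).filter (· ≠ 0)).card : ENNReal) * (2 * (tower (2 ^ i) : ENNReal)⁻¹) := by simp
    _ ≤ (box d k).card * (2 * (tower (2 ^ i) : ENNReal)⁻¹) := by
        gcongr
        exact Finset.filter_subset _ _

end RandomColoring

/-! ### Towers and the iterated logarithm -/

lemma tower_strictMono : StrictMono tower := strictMono_nat_of_lt_succ fun _ => Nat.lt_two_pow_self

lemma le_tower_logStar (x : ℝ) : x ≤ tower (logStar x) := by
  have hne : {k : ℕ | x ≤ (tower k : ℝ)}.Nonempty := by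
    refine ⟨⌈x⌉₊, (Nat.le_ceil x).trans ?_⟩
    exact_mod_cast tower_strictMono.le_apply
  exact Nat.sInf_mem hne

lemma one_le_logStar {x : ℝ} (hx : 1 < x) : 1 ≤ logStar x := by
  by_contra h
  have h1 := le_tower_logStar x
  have h0 : logStar x = 0 := by omega
  rw [h0] at h1
  simp only [tower, Nat.cast_one] at h1
  linarith

lemma sq_le_two_pow {n : ℕ} (hn : 4 ≤ n) : n ^ 2 ≤ 2 ^ n := by
  induction n, hn using Nat.le_induction with
  | base => norm_num
  | succ n hn ih =>
    rw [pow_succ 2]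
    nlinarith

/-! ### The uniform algorithm -/

open Classical in
/-- Extend a labelling of a ball to `ℤ^d` by the label `a`. -/
noncomputable def ballExt {d r : ℕ} {α : Type*} (a : α) (X : Ball d r → α) (v : Vertex d) : α :=
  if h : ∑ i, |v i| ≤ (r : ℤ) then X ⟨v, h⟩ else a

/-- The origin, as an element of the ball of radius `r`. -/
def ballZero (d r : ℕ) : Ball d r := ⟨0, by simp⟩

lemma ballExt_view {d r ρ : ℕ} {α : Type*} (a : α) (x : Vertex d → α) (v : Vertex d)
    (h : d * ρ ≤ r) {u : Vertex d} (hu : u ∈ box d ρ) : ballExt a (view x v r) u = x (v + u) := by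
  rw [ballExt, dif_pos (sum_abs_le_of_mem_box h hu)]
  rfl

lemma measurable_ballExt {d r : ℕ} (a : unitInterval) :
    Measurable (ballExt (d := d) (r := r) a) := by
  refine measurable_pi_lambda _ fun v => ?_
  by_cases h : ∑ i, |v i| ≤ (r : ℤ)
  · simp only [ballExt, h, dite_true]
    exact measurable_pi_apply _
  · simp only [ballExt, h, dite_false]
    exact measurable_const

section Uniform

variable {d : ℕ} {In Out : Type*}

open Classical in
/-- Run the local algorithm `F` on a partial colouring, if the colouring is defined on the box of
radius `R` around the vertex. -/
noncomputable def runIfColored (R : ℕ) (F : (Vertex d → ℕ × In) → Vertex d → Out)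
    (s : Vertex d → Option ℕ × In) (v : Vertex d) : Option Out :=
  if ∀ u ∈ box d R, (s (v + u)).1 ≠ none then
    some (F (fun w => ((s w).1.getD 0, (s w).2)) v)
  else none

/-- Run the local algorithm `F` on the colouring of stage `i`, if it is defined on the box of radius
`R` around the vertex. -/
noncomputable def attempt (k R : ℕ) (F : (Vertex d → ℕ × In) → Vertex d → Out) (i : ℕ)
    (s : Vertex d → In × unitInterval) : Vertex d → Option Out :=
  runIfColored R F fun w => (stage k i (fun w => (s w).2) w, (s w).1)

variable {k R : ℕ} {F : (Vertex d → ℕ × In) → Vertex d → Out}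

lemma isLocal_runIfColored (hF : IsLocal R F) : IsLocal R (runIfColored R F) := by
  intro s s' v v' h
  have hiff : (∀ u ∈ box d R, (s (v + u)).1 ≠ none) ↔ ∀ u ∈ box d R, (s' (v' + u)).1 ≠ none := by
    refine forall_congr' fun u => forall_congr' fun hu => ?_
    rw [h u hu]
  have hval : F (fun w => ((s w).1.getD 0, (s w).2)) v =
      F (fun w => ((s' w).1.getD 0, (s' w).2)) v' :=
    hF _ _ _ _ fun u hu => by rw [h u hu]
  unfold runIfColored
  simp only [hiff, hval]

lemma isLocal_attempt (hF : IsLocal R F) (i : ℕ) :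
    IsLocal (R + k * (cvPalette d k + 2) * 2 ^ i) (attempt k R F i) := by
  have h := (isLocal_runIfColored hF).comp
    (((isLocal_stage (k := k) i).comp
      (IsLocal.of_pointwise (Prod.snd : In × unitInterval → unitInterval))).prodMk
      (IsLocal.of_pointwise (Prod.fst : In × unitInterval → In)))
  rwa [add_zero, Nat.max_zero] at h

lemma measurableSet_attempt (hF : IsLocal R F) (i : ℕ) (x : Vertex d → In) (o : Option Out) :
    MeasurableSet {y : Vertex d → unitInterval | attempt k R F i (fun w => (x w, y w)) 0 = o} :=
  measurableSet_of_dependsOn R (ξ := stage k i) (fun u a => measurableSet_stage i u a)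
    (Q := fun κ => runIfColored R F (fun w => (κ w, x w)) 0 = o) fun κ κ' h hκ => by
      rw [← hκ]
      exact isLocal_runIfColored hF _ _ _ _ fun u hu => by rw [zero_add, h u hu]

/-- The radius at which the algorithm decides whether it stops after stage `i`. -/
noncomputable def stopRadius (d k R i : ℕ) : ℕ := (d * (R + k * (cvPalette d k + 2)) + 1) * 2 ^ i

lemma stopRadius_strictMono : StrictMono (stopRadius d k R) := by
  intro i j hij
  exact Nat.mul_lt_mul_of_pos_left (Nat.pow_lt_pow_right (by norm_num) hij) (Nat.succ_pos _)

lemma le_stopRadius (i : ℕ) : d * (R + k * (cvPalette d k + 2) * 2 ^ i) ≤ stopRadius d k R i := by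
  have h : 1 ≤ 2 ^ i := Nat.one_le_two_pow
  unfold stopRadius
  generalize cvPalette d k = Q
  calc d * (R + k * (Q + 2) * 2 ^ i) ≤ d * (R * 2 ^ i + k * (Q + 2) * 2 ^ i) := by
        gcongr
        exact Nat.le_mul_of_pos_right R h
    _ = (d * (R + k * (Q + 2))) * 2 ^ i := by ring
    _ ≤ _ := Nat.mul_le_mul_right _ (Nat.le_succ _)

open Classical in
/-- The rule of the uniform algorithm that runs `F` on the colouring that is computed from the
random labels. -/
noncomputable def uniformRule (k R : ℕ) (F : (Vertex d → ℕ × In) → Vertex d → Out) (r : ℕ)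
    (X : Ball d r → In) (Y : Ball d r → unitInterval) : Option Out :=
  if h : ∃ i, stopRadius d k R i = r then
    attempt k R F h.choose
      (fun w => (ballExt (X (ballZero d r)) X w, ballExt 0 Y w)) 0
  else none

lemma measurable_uniformRule (hF : IsLocal R F) (r : ℕ) (X : Ball d r → In) (o : Option Out) :
    MeasurableSet {Y | uniformRule k R F r X Y = o} := by
  by_cases h : ∃ i, stopRadius d k R i = r
  · simp only [uniformRule, h, dite_true]
    exact measurable_ballExt 0
      (measurableSet_attempt hF h.choose (ballExt (X (ballZero d r)) X) o)
  · simp [uniformRule, h]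

/-- The uniform algorithm with the rule `uniformRule`. -/
noncomputable def uniformAlgorithm (k : ℕ) (hF : IsLocal R F) : UniformAlgorithm d In Out where
  rule := uniformRule k R F
  measurable_rule := measurable_uniformRule hF

lemma uniformRule_stopRadius (hF : IsLocal R F) (x : Vertex d → In) (y : Vertex d → unitInterval)
    (v : Vertex d) (i : ℕ) :
    uniformRule k R F (stopRadius d k R i) (view x v _) (view y v _) =
      attempt k R F i (fun w => (x w, y w)) v := by
  have hex : ∃ j, stopRadius d k R j = stopRadius d k R i := ⟨i, rfl⟩
  rw [uniformRule, dif_pos hex, stopRadius_strictMono.injective hex.choose_spec]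
  refine isLocal_attempt hF i _ _ _ _ fun u hu => ?_
  rw [zero_add, ballExt_view _ _ _ (le_stopRadius i) hu, ballExt_view _ _ _ (le_stopRadius i) hu]

lemma ae_exists_stage (k : ℕ) : ∀ᵐ y ∂(iidLaw d), ∀ v, ∃ i, stage k i y v ≠ none := by
  rw [ae_all_iff]
  intro v
  rw [ae_iff]
  push Not
  have htend : Tendsto (fun i : ℕ => ((box d k).card : ENNReal) *
      (2 * (tower (2 ^ i) : ENNReal)⁻¹)) atTop (𝓝 0) := by
    have h1 : Tendsto (fun i : ℕ => tower (2 ^ i)) atTop atTop :=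
      tower_strictMono.tendsto_atTop.comp (tendsto_pow_atTop_atTop_of_one_lt (by norm_num))
    have h2 : Tendsto (fun i : ℕ => (tower (2 ^ i) : ENNReal)⁻¹) atTop (𝓝 0) :=
      ENNReal.tendsto_inv_nat_nhds_zero.comp h1
    have h3 := ENNReal.Tendsto.const_mul (a := 2) h2 (Or.inr (by simp))
    rw [mul_zero] at h3
    have h4 := ENNReal.Tendsto.const_mul (a := ((box d k).card : ENNReal)) h3
      (Or.inr (ENNReal.natCast_ne_top _))
    rwa [mul_zero] at h4
  refine le_antisymm (ge_of_tendsto' htend fun i => ?_) zero_le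
  exact (measure_mono fun y (hy : ∀ i, stage k i y v = none) => hy (i + 1)).trans
    (measure_stage_eq_none_le i v)

lemma uniformAlgorithm_solves {t : ℕ} {P : LCL d t In Out} (hF : IsLocal R F)
    (hsol : ∀ s : Vertex d → ℕ × In, (ProperAt k fun v => (s v).1) →
      (∀ v, (s v).1 < (box d k).card + 1) → P.IsColoring (fun v => (s v).2) (F s)) :
    (uniformAlgorithm k hF).Solves P := by
  classical
  intro x
  filter_upwards [ae_exists_stage k] with y hy
  choose i₀ hi₀ using hy
  set col : Vertex d → ℕ := fun v => (stage k (i₀ v) y v).getD 0 with hcoldef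
  have hsome : ∀ v, stage k (i₀ v) y v = some (col v) := by
    intro v
    obtain ⟨c, hc⟩ := Option.ne_none_iff_exists'.1 (hi₀ v)
    simp [hcoldef, hc]
  have hcol : ∀ v i c, stage k i y v = some c → c = col v := by
    intro v i c hc
    have h1 := stage_mono (le_max_left i (i₀ v)) hc
    have h2 := stage_mono (le_max_right i (i₀ v)) (hsome v)
    rw [h1] at h2
    exact Option.some.inj h2
  refine ⟨F fun v => (col v, x v), fun v => ?_, hsol (fun v => (col v, x v)) ?_ ?_⟩
  · have hex : ∃ i, ∀ u ∈ box d R, stage k i y (v + u) ≠ none := by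
      refine ⟨(box d R).sup fun u => i₀ (v + u), fun u hu => ?_⟩
      rw [stage_mono (Finset.le_sup (f := fun u => i₀ (v + u)) hu) (hsome (v + u))]
      simp
    refine ⟨stopRadius d k R (Nat.find hex), ?_, fun r hr => ?_⟩
    · change uniformRule k R F _ _ _ = _
      rw [uniformRule_stopRadius hF]
      unfold attempt runIfColored
      rw [if_pos (Nat.find_spec hex)]
      refine congrArg some (hF _ _ _ _ fun u hu => ?_)
      obtain ⟨c, hc⟩ := Option.ne_none_iff_exists'.1 (Nat.find_spec hex u hu)
      simp only [hc, Option.getD_some, hcol _ _ _ hc]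
    · change uniformRule k R F _ _ _ = _
      by_cases hrad : ∃ i, stopRadius d k R i = r
      · obtain ⟨i, rfl⟩ := hrad
        rw [uniformRule_stopRadius hF]
        unfold attempt runIfColored
        rw [if_neg (Nat.find_min hex (stopRadius_strictMono.lt_iff_lt.1 hr))]
      · rw [uniformRule, dif_neg hrad]
  · intro v u hu hu0
    exact partialProper_stage _ y u hu hu0 v _ _
      (stage_mono (le_max_left (i₀ v) (i₀ (v + u))) (hsome v))
      (stage_mono (le_max_right (i₀ v) (i₀ (v + u))) (hsome (v + u)))
  · exact fun v => Nat.lt_succ_of_le (stage_le (hsome v))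

lemma exists_stage_eq_none_of_lt_codingRadius (hF : IsLocal R F) {x : Vertex d → In}
    {y : Vertex d → unitInterval} {i : ℕ}
    (h : stopRadius d k R i < (uniformAlgorithm k hF).codingRadius x y) :
    ∃ u ∈ box d R, stage k i y u = none := by
  by_contra! hcon
  refine absurd h (not_lt.2 (iInf₂_le _ ?_))
  change uniformRule k R F _ _ _ ≠ _
  rw [uniformRule_stopRadius hF]
  unfold attempt runIfColored
  rw [if_pos fun u hu => by rw [zero_add]; exact hcon u hu]
  simp

lemma measure_codingRadius_le (hF : IsLocal R F) (x : Vertex d → In) (i : ℕ) :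
    iidLaw d {y | (stopRadius d k R (i + 1) : ℕ∞) < (uniformAlgorithm k hF).codingRadius x y} ≤
      ((2 * (box d R).card * (box d k).card : ℕ) : ENNReal) * (tower (2 ^ i) : ENNReal)⁻¹ := by
  calc _ ≤ iidLaw d (⋃ u ∈ box d R, {y | stage k (i + 1) y u = none}) := by
        refine measure_mono fun y hy => ?_
        simpa using exists_stage_eq_none_of_lt_codingRadius hF hy
    _ ≤ ∑ u ∈ box d R, iidLaw d {y | stage k (i + 1) y u = none} :=
        measure_biUnion_finset_le _ _
    _ ≤ ∑ _u ∈ box d R, (box d k).card * (2 * (tower (2 ^ i) : ENNReal)⁻¹) :=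
        Finset.sum_le_sum fun u _ => measure_stage_eq_none_le i u
    _ = _ := by
        rw [Finset.sum_const, nsmul_eq_mul]
        push_cast
        ring

lemma natCast_lt_codingRadius {n : ℕ} {c : ℕ∞} :
    (((n : ℝ) : EReal) < ((c : ENNReal) : EReal)) ↔ (n : ℕ∞) < c := by
  have h : ((n : ℝ) : EReal) = (((n : ℕ∞) : ENNReal) : EReal) := by
    rw [ENat.toENNReal_coe, ← ENNReal.ofReal_natCast, EReal.coe_ennreal_ofReal,
      max_eq_left (Nat.cast_nonneg n)]
  rw [h, EReal.coe_ennreal_lt_coe_ennreal_iff, ENat.toENNReal_lt]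

/-- The stage at which the failure probability has dropped below `ε`, for small `ε`. -/
noncomputable def stageFor (ε : ℝ) : ℕ := Nat.clog 2 (logStar (1 / ε) + 1)

lemma tower_stageFor_ge (m : ℕ) :
    ∀ᶠ ε in 𝓝[>] (0 : ℝ), (m : ENNReal) * (tower (2 ^ stageFor ε) : ENNReal)⁻¹ ≤
      ENNReal.ofReal ε := by
  have hev : ∀ᶠ ε in 𝓝[>] (0 : ℝ), ((m + 4 : ℕ) : ℝ) ≤ ε⁻¹ :=
    tendsto_inv_nhdsGT_zero.eventually_ge_atTop _
  filter_upwards [hev, self_mem_nhdsWithin] with ε hε hpos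
  have hpos : 0 < ε := hpos
  set T := tower (logStar (1 / ε)) with hT
  have h1 : ε⁻¹ ≤ T := by
    rw [← one_div]
    exact le_tower_logStar (1 / ε)
  have hmT : m + 4 ≤ T := by exact_mod_cast hε.trans h1
  have h2 : m * T ≤ tower (2 ^ stageFor ε) := by
    calc m * T ≤ T ^ 2 := by nlinarith
      _ ≤ 2 ^ T := sq_le_two_pow (by omega)
      _ = tower (logStar (1 / ε) + 1) := rfl
      _ ≤ tower (2 ^ stageFor ε) := tower_strictMono.monotone (Nat.le_pow_clog (by norm_num) _)
  have hTε : (T : ENNReal)⁻¹ ≤ ENNReal.ofReal ε := by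
    have hT0 : (0 : ℝ) < T := by exact_mod_cast (by omega : 0 < T)
    rw [← ENNReal.ofReal_natCast, ← ENNReal.ofReal_inv_of_pos hT0]
    exact ENNReal.ofReal_le_ofReal (inv_le_of_inv_le₀ hpos h1)
  refine le_trans ?_ hTε
  rw [ENNReal.le_inv_iff_mul_le, mul_right_comm, ← div_eq_mul_inv]
  refine ENNReal.div_le_of_le_mul ?_
  rw [one_mul]
  exact_mod_cast h2

/-- A local algorithm that is given a colouring with finitely many colours yields a uniform
algorithm, if the colouring is computed from the random labels. -/
theorem LCL.inULOCALLogStar_of_local {t : ℕ} {P : LCL d t In Out} (hF : IsLocal R F)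
    (hsol : ∀ s : Vertex d → ℕ × In, (ProperAt k fun v => (s v).1) →
      (∀ v, (s v).1 < (box d k).card + 1) → P.IsColoring (fun v => (s v).2) (F s)) :
    P.InULOCALLogStar := by
  refine ⟨fun ε => (stopRadius d k R (stageFor ε + 1) : ℝ), ?_, uniformAlgorithm k hF,
    uniformAlgorithm_solves hF hsol, ?_⟩
  · refine IsBigO.of_bound (8 * (d * (R + k * (cvPalette d k + 2)) + 1 : ℕ)) ?_
    have hev : ∀ᶠ ε in 𝓝[>] (0 : ℝ), (2 : ℝ) ≤ ε⁻¹ :=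
      tendsto_inv_nhdsGT_zero.eventually_ge_atTop _
    filter_upwards [hev] with ε hε
    have hL : 1 ≤ logStar (1 / ε) := one_le_logStar (by rw [one_div]; linarith)
    have hclog : 2 ^ stageFor ε ≤ 2 * (logStar (1 / ε) + 1) := by
      have h1 := Nat.pow_pred_clog_lt_self (b := 2) (by norm_num)
        (x := logStar (1 / ε) + 1) (by omega)
      have h2 : stageFor ε ≠ 0 := (Nat.clog_pos (by norm_num) (by omega)).ne'
      obtain ⟨j, hj⟩ := Nat.exists_eq_succ_of_ne_zero h2
      have h3 : Nat.clog 2 (logStar (1 / ε) + 1) = j + 1 := hj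
      rw [h3, Nat.pred_succ] at h1
      rw [hj, Nat.succ_eq_add_one, pow_succ]
      omega
    rw [Real.norm_of_nonneg (Nat.cast_nonneg _), Real.norm_of_nonneg (Nat.cast_nonneg _)]
    have hnat : stopRadius d k R (stageFor ε + 1) ≤
        8 * (d * (R + k * (cvPalette d k + 2)) + 1) * logStar (1 / ε) := by
      unfold stopRadius
      rw [pow_succ]
      generalize d * (R + k * (cvPalette d k + 2)) + 1 = D
      calc D * (2 ^ stageFor ε * 2) ≤ D * (8 * logStar (1 / ε)) :=
            Nat.mul_le_mul_left _ (by omega)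
        _ = _ := by ring
    exact_mod_cast hnat
  · filter_upwards [tower_stageFor_ge (2 * (box d R).card * (box d k).card)] with ε hε x
    simp only [natCast_lt_codingRadius]
    exact (measure_codingRadius_le hF x (stageFor ε)).trans hε

end Uniform

/-! ### The deterministic algorithm on tori -/

section LocalModel

variable {d : ℕ} {In Out : Type*}

/-- The covering map from `ℤ^d` to the torus. -/
def toTorus {d : ℕ} (m : Fin d → ℕ) (v : Vertex d) : Torus m := fun i => ((v i : ℤ) : ZMod (m i))

lemma toTorus_surjective (m : Fin d → ℕ) : Function.Surjective (toTorus m) := by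
  intro w
  choose v hv using fun i => ZMod.intCast_surjective (w i)
  exact ⟨v, funext hv⟩

lemma toTorus_add (m : Fin d → ℕ) (v u : Vertex d) :
    toTorus m (v + u) = toTorus m v + toTorus m u := by
  funext i
  simp [toTorus]

lemma torusView_toTorus {m : Fin d → ℕ} {α : Type*} (x : Torus m → α) (v : Vertex d) (r : ℕ) :
    torusView x (toTorus m v) r = view (fun w => x (toTorus m w)) v r := by
  funext u
  simp only [view, toTorus_add]
  rfl

/-- Unique identifiers on a torus of side lengths more than `k` lift to a labelling of `ℤ^d` that
distinguishes the vertices of sup distance at most `k`. -/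
lemma properAt_ids {m : Fin d → ℕ} {k : ℕ} (hm : ∀ i, k < m i) {ids : Torus m → ℕ}
    (hids : Function.Injective ids) : ProperAt k fun v => ids (toTorus m v) := by
  intro v u hu hu0 h
  apply hu0
  funext i
  have h1 := congrFun (hids h) i
  rw [toTorus_add, Pi.add_apply, left_eq_add] at h1
  refine Int.eq_zero_of_abs_lt_dvd ((ZMod.intCast_zmod_eq_zero_iff_dvd _ _).1 h1) ?_
  refine (mem_box.1 hu i).trans_lt ?_
  exact_mod_cast hm i

/-- Run `F` on the colouring that is computed from the identifiers in `j` steps. -/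
noncomputable def runOnIds (k j : ℕ) (F : (Vertex d → ℕ × In) → Vertex d → Out)
    (s : Vertex d → ℕ × In) : Vertex d → Out :=
  F fun w => ((reduceAll k j (fun w => some (s w).1) w).getD 0, (s w).2)

lemma isLocal_runOnIds {k j R : ℕ} {F : (Vertex d → ℕ × In) → Vertex d → Out} (hF : IsLocal R F) :
    IsLocal (R + k * j) (runOnIds k j F) := by
  have h1 : IsLocal (d := d) 0 fun (s : Vertex d → ℕ × In) w => some (s w).1 :=
    IsLocal.of_pointwise fun a : ℕ × In => some a.1
  have h2 : IsLocal (d := d) 0 fun (s : Vertex d → ℕ × In) w => (s w).2 :=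
    IsLocal.of_pointwise Prod.snd
  have h3 := hF.comp (((IsLocal.of_pointwise fun o : Option ℕ => o.getD 0).comp
    ((isLocal_reduceAll k j).comp h1)).prodMk h2)
  rwa [Nat.max_zero, add_zero, zero_add] at h3

/-- A local algorithm that is given a colouring with finitely many colours yields a deterministic
algorithm on tori, if the colouring is computed from the identifiers. -/
theorem LCL.inLOCALLogStar_of_local (hd : d ≠ 0) [Nonempty Out] {t k R : ℕ} {P : LCL d t In Out}
    {F : (Vertex d → ℕ × In) → Vertex d → Out} (hF : IsLocal R F)
    (hsol : ∀ s : Vertex d → ℕ × In, (ProperAt k fun v => (s v).1) →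
      (∀ v, (s v).1 < cvPalette d k) → P.IsColoring (fun v => (s v).2) (F s)) :
    P.InLOCALLogStar := by
  intro K e hK
  refine ⟨⟨fun n => d * (R + k * (logStar n + 2)), fun n ids x =>
    runOnIds k (logStar n + 2) F
      (fun w => (ballExt 0 ids w, ballExt (x (ballZero d _)) x w)) 0⟩, ?_, ?_⟩
  · refine IsBigO.of_bound (d * (R + 3 * k) : ℕ) ?_
    filter_upwards [eventually_ge_atTop 2] with n hn
    have hL : 1 ≤ logStar (n : ℝ) := one_le_logStar (by exact_mod_cast hn)
    rw [Real.norm_of_nonneg (Nat.cast_nonneg _), Real.norm_of_nonneg (Nat.cast_nonneg _)]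
    have hnat : d * (R + k * (logStar n + 2)) ≤ d * (R + 3 * k) * logStar n := by
      rw [mul_assoc]
      refine Nat.mul_le_mul_left d ?_
      nlinarith [Nat.mul_le_mul_left R hL, Nat.mul_le_mul_left k hL]
    exact_mod_cast hnat
  · have hside : ∀ᶠ n : ℕ in atTop, K * k < (n : ℝ) ^ (1 / (d : ℝ)) := by
      refine ((tendsto_rpow_atTop ?_).comp tendsto_natCast_atTop_atTop).eventually_gt_atTop _
      have : (0 : ℝ) < d := by exact_mod_cast Nat.pos_of_ne_zero hd
      positivity
    filter_upwards [hside, eventually_ge_atTop (e + 4)] with n hn hne m _ hm ids hinj hids x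
    have hmk : ∀ i, k < m i := by
      intro i
      have h1 := (hm i).1
      rw [div_le_iff₀ hK] at h1
      have h2 : (k : ℝ) < m i := by
        by_contra hle
        push Not at hle
        nlinarith
      exact_mod_cast h2
    have hbound : ∀ w, ids w < cvBound (logStar n + 2) := by
      intro w
      have hT : n ≤ tower (logStar n) := by exact_mod_cast le_tower_logStar (n : ℝ)
      have h1 : n ^ e ≤ tower (logStar n + 2) := by
        calc n ^ e ≤ (2 ^ n) ^ e := Nat.pow_le_pow_left Nat.lt_two_pow_self.le e
          _ = 2 ^ (n * e) := (pow_mul 2 n e).symm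
          _ ≤ 2 ^ (2 ^ n) := by
              refine Nat.pow_le_pow_right (by norm_num) (le_trans ?_ (sq_le_two_pow (by omega)))
              nlinarith
          _ ≤ 2 ^ (2 ^ tower (logStar n)) :=
              Nat.pow_le_pow_right (by norm_num) (Nat.pow_le_pow_right (by norm_num) hT)
          _ = tower (logStar n + 2) := rfl
      have h2 := four_mul_tower_le_cvBound (logStar n + 2)
      have h3 := one_le_tower (logStar n + 2)
      have h4 := (hids w).2
      omega
    set ids' : Vertex d → ℕ := fun v => ids (toTorus m v) with hids'
    set x' : Vertex d → In := fun v => x (toTorus m v) with hx'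
    set j := logStar (n : ℝ) + 2 with hj
    have hrun : ∀ v, runOnIds k j F (fun w =>
        (ballExt 0 (torusView ids (toTorus m v) (d * (R + k * j))) w,
        ballExt (torusView x (toTorus m v) (d * (R + k * j)) (ballZero d (d * (R + k * j))))
          (torusView x (toTorus m v) (d * (R + k * j))) w)) 0 =
        runOnIds k j F (fun w => (ids' w, x' w)) v := by
      intro v
      refine isLocal_runOnIds hF _ _ _ _ fun u hu => ?_
      rw [torusView_toTorus, torusView_toTorus, zero_add, ballExt_view _ _ _ le_rfl hu,
        ballExt_view _ _ _ le_rfl hu]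
    have hred : ∀ v, ∃ c, reduceAll k j (fun w => some (ids' w)) v = some c := fun v => ⟨_, rfl⟩
    have hproper : PartialProper k (reduceAll k j fun w => some (ids' w)) := by
      refine PartialProper.reduceAll (fun u hu hu0 v a b ha hb => ?_) fun v a ha => ?_
      · rw [Option.some.injEq] at ha hb
        rw [← ha, ← hb]
        exact properAt_ids hmk hinj v u hu hu0
      · rw [Option.some.injEq] at ha
        rw [← ha]
        exact hbound _
    have hcoloring := hsol
      (fun w => ((reduceAll k j (fun w => some (ids' w)) w).getD 0, x' w)) (by
        intro v u hu hu0
        obtain ⟨a, ha⟩ := hred v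
        obtain ⟨b, hb⟩ := hred (v + u)
        simp only [ha, hb, Option.getD_some]
        exact hproper u hu hu0 v a b ha hb) (by
        intro v
        obtain ⟨a, ha⟩ := hred v
        simp only [ha, Option.getD_some]
        exact reduceAll_lt ha)
    intro w
    obtain ⟨v, rfl⟩ := toTorus_surjective m w
    rw [torusView_toTorus]
    simp only [hrun]
    exact hcoloring v

end LocalModel

/-! ### Speed-up -/

lemma pow_le_pow_add {a b : ℕ} (h : b ≤ a) (n : ℕ) :
    a ^ (n + 1) ≤ b ^ (n + 1) + (n + 1) * ((a - b) * a ^ n) := by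
  obtain ⟨c, rfl⟩ := Nat.exists_eq_add_of_le h
  rw [Nat.add_sub_cancel_left]
  induction n with
  | zero => simp
  | succ n ih =>
    have h1 : b ^ (n + 1) ≤ (b + c) ^ (n + 1) := Nat.pow_le_pow_left h _
    calc (b + c) ^ (n + 1 + 1) = (b + c) * (b + c) ^ (n + 1) := pow_succ' _ _
      _ ≤ (b + c) * (b ^ (n + 1) + (n + 1) * (c * (b + c) ^ n)) := Nat.mul_le_mul_left _ ih
      _ = b ^ (n + 1 + 1) + c * b ^ (n + 1) + (n + 1) * (c * (b + c) ^ (n + 1)) := by ring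
      _ ≤ b ^ (n + 1 + 1) + c * (b + c) ^ (n + 1) + (n + 1) * (c * (b + c) ^ (n + 1)) := by gcongr
      _ = _ := by ring

lemma card_shell_le {n r t : ℕ} (hr : 0 < r) (ht : 2 * t ≤ r) :
    (shell (n + 1) r t).card ≤ (n + 1) * (4 * t) * 5 ^ n * r ^ n := by
  have hsub : box (n + 1) r ⊆ box (n + 1) (r + 2 * t) := fun u hu => box_mono (by omega) hu
  rw [shell, Finset.card_sdiff_of_subset hsub, card_box, card_box, Nat.sub_le_iff_le_add']
  refine (pow_le_pow_add (by omega : 2 * r + 1 ≤ 2 * (r + 2 * t) + 1) n).trans ?_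
  refine Nat.add_le_add_left ?_ _
  have h1 : 2 * (r + 2 * t) + 1 - (2 * r + 1) = 4 * t := by omega
  have h2 : (2 * (r + 2 * t) + 1) ^ n ≤ (5 * r) ^ n := Nat.pow_le_pow_left (by omega) n
  rw [h1]
  calc (n + 1) * (4 * t * (2 * (r + 2 * t) + 1) ^ n) ≤ (n + 1) * (4 * t * (5 * r) ^ n) := by gcongr
    _ = _ := by rw [mul_pow]; ring

/-- A failure probability less than `1 / (threshold d t * r ^ (d - 1))` after radius `r` is small
enough for the local lemma. -/
def threshold (d t : ℕ) : ℕ := (9 ^ d + 1) ^ 9 ^ d * (d * (4 * t) * 5 ^ (d - 1)) + 1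

section SpeedUp

variable {d t : ℕ} {In Out : Type*} {P : LCL d t In Out}

/-- If for some radius `r` the algorithm fails to stop with probability less than a constant times
`r ^ (1 - d)`, then the problem can be solved much faster. -/
theorem LCL.speed_up (hd : d ≠ 0) [Finite Out] {A : UniformAlgorithm d In Out} (hA : A.Solves P)
    {r : ℕ} (hr : 0 < r) (ht : 2 * t ≤ r) {ε : ℝ}
    (hε : ∀ x, iidLaw d {y | (r : ℕ∞) < A.codingRadius x y} ≤ ENNReal.ofReal ε)
    (hsmall : threshold d t * r ^ (d - 1) * ε < 1) (hε0 : 0 ≤ ε) :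
    P.InULOCALLogStar ∧ P.InLOCALLogStar := by
  rcases isEmpty_or_nonempty In with hIn | hIn
  · refine ⟨⟨fun _ => 0, isBigO_zero _ _, A, hA, ?_⟩, fun K e _ =>
      ⟨⟨fun _ => 0, fun n _ x => isEmptyElim (x (ballZero d _))⟩, ?_, ?_⟩⟩
    · exact Eventually.of_forall fun ε x => isEmptyElim (x 0)
    · simpa using isBigO_zero _ _
    · exact Eventually.of_forall fun n m _ _ _ _ _ x => isEmptyElim (x 0)
  · have hOut : Nonempty Out := by
      obtain ⟨y, c, -⟩ := (hA fun _ => Classical.arbitrary In).exists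
      exact ⟨c 0⟩
    have hlt : ((9 ^ d + 1 : ℕ) : ENNReal) ^ (9 ^ d) *
        ((shell d r t).card * ENNReal.ofReal ε) < 1 := by
      obtain ⟨n, rfl⟩ := Nat.exists_eq_succ_of_ne_zero hd
      set N : ℕ := (9 ^ (n + 1) + 1) ^ 9 ^ (n + 1) * (shell (n + 1) r t).card with hN
      have hle : N ≤ threshold (n + 1) t * r ^ n := by
        calc N ≤ (9 ^ (n + 1) + 1) ^ 9 ^ (n + 1) * ((n + 1) * (4 * t) * 5 ^ n * r ^ n) :=
              Nat.mul_le_mul_left _ (card_shell_le hr ht)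
          _ = (9 ^ (n + 1) + 1) ^ 9 ^ (n + 1) * ((n + 1) * (4 * t) * 5 ^ n) * r ^ n :=
              (mul_assoc _ _ _).symm
          _ ≤ _ := Nat.mul_le_mul_right _ (Nat.le_succ _)
      have hreal : (N : ℝ) * ε < 1 := by
        refine lt_of_le_of_lt ?_ hsmall
        refine mul_le_mul_of_nonneg_right ?_ hε0
        exact_mod_cast hle
      have hennreal : ((9 ^ (n + 1) + 1 : ℕ) : ENNReal) ^ (9 ^ (n + 1)) *
          ((shell (n + 1) r t).card * ENNReal.ofReal ε) = ENNReal.ofReal (N * ε) := by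
        rw [ENNReal.ofReal_mul (Nat.cast_nonneg _), ENNReal.ofReal_natCast, ← mul_assoc, hN,
          Nat.cast_mul, Nat.cast_pow]
      rw [Nat.succ_eq_add_one, hennreal]
      exact ENNReal.ofReal_lt_one.2 hreal
    constructor
    · obtain ⟨R, F, hF, hsol⟩ := LCL.exists_local_solver hr ht hA hε hlt
        ((box d (8 * r)).card + 1)
      exact LCL.inULOCALLogStar_of_local hF hsol
    · obtain ⟨R, F, hF, hsol⟩ := LCL.exists_local_solver hr ht hA hε hlt (cvPalette d (8 * r))
      exact LCL.inLOCALLogStar_of_local hd hF hsol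

lemma UniformAlgorithm.HasComplexity.mono {A : UniformAlgorithm d In Out} {f g : ℝ → ℝ}
    (hA : A.HasComplexity f) (hfg : ∀ᶠ ε in 𝓝[>] (0 : ℝ), f ε ≤ g ε) : A.HasComplexity g := by
  filter_upwards [hA, hfg] with ε hε hle x
  refine (measure_mono fun y hy => ?_).trans (hε x)
  exact lt_of_le_of_lt (EReal.coe_le_coe_iff.2 hle) hy

lemma logStar_le {x : ℝ} (hx : 1 ≤ x) : (logStar x : ℝ) ≤ Real.logb 2 x + 2 := by
  have h1 : logStar x ≤ ⌈Real.logb 2 x⌉₊ + 1 := by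
    refine Nat.sInf_le ?_
    change x ≤ (tower (⌈Real.logb 2 x⌉₊ + 1) : ℝ)
    calc x = (2 : ℝ) ^ Real.logb 2 x :=
          (Real.rpow_logb (by norm_num) (by norm_num) (by linarith)).symm
      _ ≤ (2 : ℝ) ^ (⌈Real.logb 2 x⌉₊ : ℝ) :=
          Real.rpow_le_rpow_of_exponent_le (by norm_num) (Nat.le_ceil _)
      _ = ((2 ^ ⌈Real.logb 2 x⌉₊ : ℕ) : ℝ) := by rw [Real.rpow_natCast]; norm_cast
      _ ≤ (tower (⌈Real.logb 2 x⌉₊ + 1) : ℝ) := by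
          exact_mod_cast Nat.pow_le_pow_right (by norm_num) tower_strictMono.le_apply
  have h2 := Nat.ceil_lt_add_one (Real.logb_nonneg (b := 2) (by norm_num) hx)
  have h3 : (logStar x : ℝ) ≤ (⌈Real.logb 2 x⌉₊ : ℝ) + 1 := by exact_mod_cast h1
  linarith

lemma isLittleO_logStar_rpow {a : ℝ} (ha : 0 < a) :
    (fun x : ℝ => (logStar x : ℝ)) =o[atTop] fun x => x ^ a := by
  have h1 : (fun x : ℝ => Real.logb 2 x + 2) =o[atTop] fun x => x ^ a := by
    refine IsLittleO.add ?_ ?_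
    · refine ((isLittleO_log_rpow_atTop ha).const_mul_left (Real.log 2)⁻¹).congr_left fun x => ?_
      rw [Real.logb, div_eq_inv_mul]
    · refine isLittleO_const_left.2 (Or.inr ?_)
      exact tendsto_norm_atTop_atTop.comp (tendsto_rpow_atTop ha)
  refine IsBigO.trans_isLittleO (IsBigO.of_bound 1 ?_) h1
  filter_upwards [eventually_ge_atTop 1] with x hx
  have h2 := logStar_le hx
  rw [Real.norm_of_nonneg (Nat.cast_nonneg _), one_mul]
  exact h2.trans (le_abs_self _)

lemma LCL.InULOCALLogStar.inULOCAL (h : P.InULOCALLogStar) {C a : ℝ} (hC : 0 < C) (ha : 0 < a) :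
    P.InULOCAL fun ε => C * (1 / ε) ^ a := by
  obtain ⟨f, hf, A, hA, hAf⟩ := h
  refine ⟨A, hA, hAf.mono ?_⟩
  have h1 : (fun ε : ℝ => (logStar (1 / ε) : ℝ)) =o[𝓝[>] (0 : ℝ)] fun ε => (1 / ε) ^ a := by
    have h2 : Tendsto (fun ε : ℝ => 1 / ε) (𝓝[>] 0) atTop := by
      simpa only [one_div] using tendsto_inv_nhdsGT_zero
    exact (isLittleO_logStar_rpow ha).comp_tendsto h2
  filter_upwards [(hf.trans_isLittleO h1).bound hC, self_mem_nhdsWithin] with ε hε hpos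
  have hpos : 0 < ε := hpos
  rw [Real.norm_of_nonneg (r := (1 / ε) ^ a) (by positivity)] at hε
  exact (le_abs_self _).trans hε

/-- The assumption says that the failure probability after radius `r` is at most
`(C / r) ^ (d - 1)`, for all large `r` and a small constant `C`. -/
theorem LCL.InULOCAL.speed_up (hd : 2 ≤ d) [Finite Out]
    (h : P.InULOCAL fun ε => (1 / (threshold d t + 1) : ℝ) * (1 / ε) ^ (1 / ((d : ℝ) - 1))) :
    P.InULOCALLogStar ∧ P.InLOCALLogStar := by
  obtain ⟨A, hA, hAf⟩ := h
  obtain ⟨n, rfl⟩ : ∃ n, d = n + 1 := ⟨d - 1, by omega⟩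
  have hn : n ≠ 0 := by omega
  set C : ℝ := 1 / (threshold (n + 1) t + 1) with hC
  have hT : (0 : ℝ) ≤ threshold (n + 1) t := Nat.cast_nonneg _
  have hC0 : 0 < C := by positivity
  have hC1 : C ≤ 1 := by
    rw [hC, div_le_one (by positivity)]
    linarith
  have hTC : threshold (n + 1) t * C < 1 := by
    rw [hC, mul_one_div, div_lt_one (by positivity)]
    linarith
  have htend : Tendsto (fun r : ℕ => (C / (r : ℝ)) ^ n) atTop (𝓝[>] 0) := by
    refine tendsto_nhdsWithin_iff.2 ⟨?_, ?_⟩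
    · have := (tendsto_const_nhds (x := C)).div_atTop (tendsto_natCast_atTop_atTop (R := ℝ))
      simpa [hn] using this.pow n
    · filter_upwards [eventually_gt_atTop 0] with r hr
      have : (0 : ℝ) < r := by exact_mod_cast hr
      exact pow_pos (div_pos hC0 this) n
  obtain ⟨r, hr, hrt⟩ := ((htend.eventually hAf).and (eventually_ge_atTop (2 * t + 1))).exists
  have hr0 : (0 : ℝ) < r := by exact_mod_cast (by omega : 0 < r)
  have hfr : C * (1 / (C / (r : ℝ)) ^ n) ^ (1 / (((n + 1 : ℕ) : ℝ) - 1)) = (r : ℝ) := by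
    have h1 : (1 : ℝ) / (((n + 1 : ℕ) : ℝ) - 1) = (n : ℝ)⁻¹ := by
      push_cast
      rw [add_sub_cancel_right, one_div]
    have h2 : 1 / (C / (r : ℝ)) ^ n = ((r : ℝ) / C) ^ n := by
      rw [one_div, ← inv_pow, inv_div]
    rw [h1, h2, Real.pow_rpow_inv_natCast (by positivity) hn]
    field_simp
  refine LCL.speed_up (by omega) hA (r := r) (by omega) (by omega) (ε := (C / (r : ℝ)) ^ n)
    (fun x => ?_) ?_ (by positivity)
  · have := hr x
    simp only [hfr, natCast_lt_codingRadius] at this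
    exact this
  · rw [Nat.add_sub_cancel, div_pow]
    have h1 : C ^ n ≤ C := pow_le_of_le_one hC0.le hC1 hn
    calc (threshold (n + 1) t : ℝ) * (r : ℝ) ^ n * (C ^ n / (r : ℝ) ^ n)
        = threshold (n + 1) t * C ^ n := by field_simp
      _ ≤ threshold (n + 1) t * C := by gcongr
      _ < 1 := hTC

/-- In dimension one the shells have bounded size, so that an arbitrarily slow decay of the failure
probability is sufficient. -/
theorem LCL.InFFIID.speed_up {P : LCL 1 t In Out} [Finite Out] (h : P.InFFIID) :
    P.InULOCALLogStar := by
  obtain ⟨f, A, hA, hAf⟩ := h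
  have hsmall : ∀ᶠ ε in 𝓝[>] (0 : ℝ), (threshold 1 t : ℝ) * ε < 1 := by
    have h1 : Tendsto (fun ε : ℝ => (threshold 1 t : ℝ) * ε) (𝓝[>] 0)
        (𝓝 ((threshold 1 t : ℝ) * 0)) :=
      (tendsto_id.const_mul _).mono_left nhdsWithin_le_nhds
    rw [mul_zero] at h1
    exact h1.eventually_lt_const one_pos
  obtain ⟨ε, ⟨hε, hlt⟩, hpos⟩ := ((hAf.and hsmall).and self_mem_nhdsWithin).exists
  have hpos : 0 < ε := hpos
  refine (LCL.speed_up one_ne_zero hA (r := max (2 * t + 1) ⌈f ε⌉₊) (by omega) (by omega)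
    (ε := ε) (fun x => (measure_mono fun y hy => ?_).trans (hε x)) ?_ hpos.le).1
  · have hf : f ε ≤ ((max (2 * t + 1) ⌈f ε⌉₊ : ℕ) : ℝ) :=
      (Nat.le_ceil _).trans (by exact_mod_cast le_max_right _ _)
    exact lt_of_le_of_lt (EReal.coe_le_coe_iff.2 hf) (natCast_lt_codingRadius.2 hy)
  · simpa using hlt

end SpeedUp

end GridLCL

theorem theorem3p1 :
    (∀ d t : ℕ, 2 ≤ d → ∃ C : ℝ, 0 < C ∧
      ∀ (In Out : Type*) [Finite In] [Finite Out] (P : GridLCL.LCL d t In Out),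
        (P.InULOCAL (fun ε => C * (1 / ε) ^ (1 / ((d : ℝ) - 1))) ↔ P.InULOCALLogStar) ∧
        (P.InULOCAL (fun ε => C * (1 / ε) ^ (1 / ((d : ℝ) - 1))) → P.InLOCALLogStar)) ∧
    (∀ (t : ℕ) (In Out : Type*) [Finite In] [Finite Out] (P : GridLCL.LCL 1 t In Out),
        P.InFFIID ↔ P.InULOCALLogStar) := by
  refine ⟨fun d t hd => ⟨1 / (GridLCL.threshold d t + 1), by positivity, fun In Out _ _ P =>
    ⟨⟨fun h => (h.speed_up hd).1, fun h => ?_⟩, fun h => (h.speed_up hd).2⟩⟩,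
    fun t In Out _ _ P => ⟨fun h => h.speed_up, fun ⟨f, _, hf⟩ => ⟨f, hf⟩⟩⟩
  have hd' : (0 : ℝ) < (d : ℝ) - 1 := by
    have : (2 : ℝ) ≤ d := by exact_mod_cast hd
    linarith
  exact h.inULOCAL (by positivity) (by positivity)
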